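/- Let $\pi:W\to M$ be a smooth real vector bundle of finite rank over a smooth finite-dimensional (Hausdorff) manifold without boundary, with a smooth connection $\nabla$ and curvature tensor $R$. For a subset $S\subseteq W$ whose fibres $S_y=S\cap W_y$ are linear subspaces, let $\mathcal S(S)$ be the set of all $w\in S$ through which there passes a smooth local section $X$ of $W$ with values in $S$, that is, $X(\pi(w))=w$; and let $\ker\alpha_S$ (the kernel of the second fundamental 1-form $\alpha_S(X(y)):=\nabla X(y)\bmod S_y$) be the set of all $w\in S$, $y=\pi(w)$, for which some smooth local section $X$ of $W$ with values in $S$ satisfies $X(y)=w$ and $\nabla_vX(y)\in S_y$ for all $v\in T_yM$. Put $$V^{(0)}=\{w\in W: R(\cdot,\cdot)w=0\},\qquad W^{(i)}=\mathcal S(V^{(i)}),\qquad V^{(i+1)}=\ker\alpha_{W^{(i)}},$$ and let $\widetilde W=\bigcap_{i}W^{(i)}$ (so that $\widetilde W=W^{(k)}$ whenever $W^{(l)}=W^{(k)}$ for all $l\ge k$). The connection $\nabla$ is called regular at $x\in M$ if there is an open neighbourhood $U$ of $x$ over which $\widetilde W$ is a vector bundle, i.e. $\widetilde W|_U$ is a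 smooth subbundle of $W|_U$. Suppose that $\nabla$ is regular at $x\in M$. Then near $x$ there are exactly $\dim\widetilde W_x$ independent local parallel sections: there are an open neighbourhood $U$ of $x$ and $\dim\widetilde W_x$ smooth sections of $W$ over $U$ that are parallel and linearly independent at every point of $U$; and any finite family of parallel sections of $W$ over an open neighbourhood of $x$ whose germs at $x$ are linearly independent over $\mathbb R$ has at most $\dim\widetilde W_x$ members. -/

import Mathlib

open Bundle Manifold Module
open scoped ContDiff Topology

set_option linter.unusedSectionVars false

noncomputable section

namespace ParallelSections

variable {E : Type*} [NormedAddCommGroup E] [NormedSpace ℝ E]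
  {M : Type*} [TopologicalSpace M] [ChartedSpace E M]
  {F : Type*} [NormedAddCommGroup F] [NormedSpace ℝ F]
  {W : M → Type*} [TopologicalSpace (TotalSpace F W)]
  [∀ x, AddCommGroup (W x)] [∀ x, Module ℝ (W x)] [∀ x, TopologicalSpace (W x)]
  [∀ x, IsTopologicalAddGroup (W x)] [∀ x, ContinuousSMul ℝ (W x)] [FiberBundle F W]

/-! ### Smooth local sections -/

variable (E F) in
/-- `X` is a smooth local section of the bundle `W` over the open set `U`. A local section is
represented by a function on all of `M`, whose values outside `U` are irrelevant. -/
def IsSmoothSectionOn (U : Set M) (X : ∀ y, W y) : Prop :=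
  IsOpen U ∧
    ContMDiffOn 𝓘(ℝ, E) (𝓘(ℝ, E).prod 𝓘(ℝ, F)) ∞ (fun y ↦ TotalSpace.mk' F y (X y)) U

variable (E F) in
/-- `X` is a smooth local section of `W` over the open set `U`, taking its values in the subset
`S` of `W` (given by a linear subspace `S y` of every fibre `W y`). -/
def IsSmoothSectionInOn (S : ∀ y, Submodule ℝ (W y)) (U : Set M) (X : ∀ y, W y) : Prop :=
  IsSmoothSectionOn E F U X ∧ ∀ y ∈ U, X y ∈ S y

section Lemmas

variable {U U' : Set M} {X Y : ∀ y, W y} {S : ∀ y, Submodule ℝ (W y)} {x : M}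

theorem IsSmoothSectionOn.mdifferentiableAt (hX : IsSmoothSectionOn E F U X) (hx : x ∈ U) :
    MDifferentiableAt 𝓘(ℝ, E) (𝓘(ℝ, E).prod 𝓘(ℝ, F)) (fun y ↦ TotalSpace.mk' F y (X y)) x :=
  (hX.2.contMDiffAt (hX.1.mem_nhds hx)).mdifferentiableAt (by simp)

variable [VectorBundle ℝ F W]

theorem IsSmoothSectionInOn.zero (S : ∀ y, Submodule ℝ (W y)) :
    IsSmoothSectionInOn E F S Set.univ (0 : ∀ y, W y) :=
  ⟨⟨isOpen_univ, (contMDiff_zeroSection (IB := 𝓘(ℝ, E)) ℝ W).contMDiffOn⟩,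
    fun y _ ↦ (S y).zero_mem⟩

theorem IsSmoothSectionInOn.add (hX : IsSmoothSectionInOn E F S U X)
    (hY : IsSmoothSectionInOn E F S U' Y) : IsSmoothSectionInOn E F S (U ∩ U') (X + Y) :=
  ⟨⟨hX.1.1.inter hY.1.1, (hX.1.2.mono Set.inter_subset_left).add_section
    (hY.1.2.mono Set.inter_subset_right)⟩,
    fun y hy ↦ (S y).add_mem (hX.2 y hy.1) (hY.2 y hy.2)⟩

theorem IsSmoothSectionInOn.const_smul (a : ℝ) (hX : IsSmoothSectionInOn E F S U X) :
    IsSmoothSectionInOn E F S U (a • X) :=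
  ⟨⟨hX.1.1, hX.1.2.const_smul_section⟩, fun y hy ↦ (S y).smul_mem a (hX.2 y hy)⟩

end Lemmas

/-! ### Parallel sections, curvature -/

/-- `X` is a local parallel section over the open set `U`: it is smooth on `U`, and `∇X = 0`
on `U`. -/
def IsParallelOn (cov : CovariantDerivative 𝓘(ℝ, E) F W) (U : Set M) (X : ∀ y, W y) : Prop :=
  IsSmoothSectionOn E F U X ∧ ∀ y ∈ U, cov X y = 0

/-- The curvature operator on sections, at the point `x`:
`R(A, B)X = ∇_A ∇_B X - ∇_B ∇_A X - ∇_[A, B] X`. -/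
def curvatureOp (cov : CovariantDerivative 𝓘(ℝ, E) F W) (A B : ∀ y : M, TangentSpace 𝓘(ℝ, E) y)
    (X : ∀ y, W y) (x : M) : W x :=
  cov (fun y ↦ cov X y (B y)) x (A x) - cov (fun y ↦ cov X y (A y)) x (B x)
    - cov X x (VectorField.mlieBracket 𝓘(ℝ, E) A B x)

/-- The curvature tensor at `x`: `R(u, v)w` is computed by extending the vectors `u`, `v` and `w`
to sections that are smooth near `x`. -/
def curvature [IsManifold 𝓘(ℝ, E) ∞ M] (cov : CovariantDerivative 𝓘(ℝ, E) F W) (x : M)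
    (u v : TangentSpace 𝓘(ℝ, E) x) (w : W x) : W x :=
  curvatureOp cov (FiberBundle.extend E u) (FiberBundle.extend E v) (FiberBundle.extend F w) x

section CurvatureLemmas

variable [FiniteDimensional ℝ E] [T2Space M] [IsManifold 𝓘(ℝ, E) ∞ M]
  [VectorBundle ℝ F W] [ContMDiffVectorBundle ∞ F W 𝓘(ℝ, E)]

/-- If `X` is smooth near `x` then so is `∇X`. -/
theorem contMDiffAt_cov (cov : CovariantDerivative 𝓘(ℝ, E) F W)
    [hc : CovariantDerivative.ContMDiffCovariantDerivative cov ∞] {U : Set M} {X : ∀ y, W y}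
    (hX : IsSmoothSectionOn E F U X) {x : M} (hx : x ∈ U) :
    ContMDiffAt 𝓘(ℝ, E) (𝓘(ℝ, E).prod 𝓘(ℝ, E →L[ℝ] F)) ∞
      (fun y ↦ TotalSpace.mk' (E →L[ℝ] F)
        (E := fun y ↦ TangentSpace 𝓘(ℝ, E) y →L[ℝ] W y) y (cov X y)) x := by
  obtain ⟨f, hf, -⟩ := (SmoothBumpFunction.nhds_basis_support (I := 𝓘(ℝ, E))
    (hX.1.mem_nhds hx)).mem_iff.1 (Filter.univ_mem)
  have hs : ContMDiff 𝓘(ℝ, E) (𝓘(ℝ, E).prod 𝓘(ℝ, F)) ∞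
      (fun y ↦ TotalSpace.mk' F y (((f : M → ℝ) • X) y)) := by
    exact ContMDiffOn.smul_section_of_tsupport f.contMDiff.contMDiffOn hX.1 hf hX.2
  have h1 := (hc.contMDiff.contMDiff (σ := (f : M → ℝ) • X)
    (by simpa using! hs.contMDiffOn)).contMDiffAt (x := x) Filter.univ_mem
  refine h1.congr_of_eventuallyEq ?_
  have hev := (f.eventuallyEq_one).eventuallyEq_nhds
  filter_upwards [hev, hX.1.mem_nhds hx] with y hy hyU
  have : cov X y = cov ((f : M → ℝ) • X) y := by
    refine (cov.isCovariantDerivativeOnUniv).congr_of_eventuallyEq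
      (hX.mdifferentiableAt hyU) (hs.mdifferentiableAt (by simp)) Filter.univ_mem ?_
    filter_upwards [hy] with z hz
    simp [hz]
  rw [this]

theorem isSmoothSectionOn_extend {x : M} (w : W x) :
    IsSmoothSectionOn E F (trivializationAt F W x).baseSet (FiberBundle.extend F w) := by
  set t := trivializationAt F W x
  refine ⟨t.open_baseSet, ?_⟩
  rw [t.contMDiffOn_section_baseSet_iff]
  exact (contMDiffOn_const (c := (t ⟨x, w⟩).2)).congr
    (fun y hy ↦ by simp [FiberBundle.extend, t, hy])

theorem extend_add {x : M} (w w' : W x) {y : M} (hy : y ∈ (trivializationAt F W x).baseSet) :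
    FiberBundle.extend F (w + w') y = (FiberBundle.extend F w + FiberBundle.extend F w') y := by
  set t := trivializationAt F W x with ht
  have hx : x ∈ t.baseSet := FiberBundle.mem_baseSet_trivializationAt' x
  have h : (t ⟨x, w + w'⟩).2 = (t ⟨x, w⟩).2 + (t ⟨x, w'⟩).2 := (t.linear ℝ hx).1 w w'
  simp only [FiberBundle.extend, Pi.add_apply, ← ht, h, ← t.symmₗ_apply (R := ℝ) hy, map_add]

theorem extend_smul {x : M} (a : ℝ) (w : W x) {y : M}
    (hy : y ∈ (trivializationAt F W x).baseSet) :
    FiberBundle.extend F (a • w) y = (a • FiberBundle.extend F w) y := by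
  set t := trivializationAt F W x with ht
  have hx : x ∈ t.baseSet := FiberBundle.mem_baseSet_trivializationAt' x
  have h : (t ⟨x, a • w⟩).2 = a • (t ⟨x, w⟩).2 := (t.linear ℝ hx).2 a w
  simp only [FiberBundle.extend, Pi.smul_apply, ← ht, h, ← t.symmₗ_apply (R := ℝ) hy, map_smul]

/-- If `X` and the vector field `A` are smooth near `x` then `∇_A X` is differentiable at `x`. -/
theorem mdifferentiableAt_cov_apply (cov : CovariantDerivative 𝓘(ℝ, E) F W)
    [CovariantDerivative.ContMDiffCovariantDerivative cov ∞] {U : Set M} {X : ∀ y, W y}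
    (hX : IsSmoothSectionOn E F U X) {x : M} (hx : x ∈ U)
    {A : ∀ y : M, TangentSpace 𝓘(ℝ, E) y}
    (hA : ContMDiffAt 𝓘(ℝ, E) (𝓘(ℝ, E).prod 𝓘(ℝ, E)) ∞ (fun y ↦ TotalSpace.mk' E y (A y)) x) :
    MDifferentiableAt 𝓘(ℝ, E) (𝓘(ℝ, E).prod 𝓘(ℝ, F))
      (fun y ↦ TotalSpace.mk' F y (cov X y (A y))) x :=
  ((contMDiffAt_cov cov hX hx).clm_bundle_apply hA).mdifferentiableAt (by simp)

theorem curvatureOp_congr (cov : CovariantDerivative 𝓘(ℝ, E) F W)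
    [CovariantDerivative.ContMDiffCovariantDerivative cov ∞] {U : Set M} {X Y : ∀ y, W y}
    (hX : IsSmoothSectionOn E F U X) (hY : IsSmoothSectionOn E F U Y) {x : M} (hx : x ∈ U)
    (hXY : ∀ y ∈ U, X y = Y y) {A B : ∀ y : M, TangentSpace 𝓘(ℝ, E) y}
    (hA : ContMDiffAt 𝓘(ℝ, E) (𝓘(ℝ, E).prod 𝓘(ℝ, E)) ∞ (fun y ↦ TotalSpace.mk' E y (A y)) x)
    (hB : ContMDiffAt 𝓘(ℝ, E) (𝓘(ℝ, E).prod 𝓘(ℝ, E)) ∞ (fun y ↦ TotalSpace.mk' E y (B y)) x) :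
    curvatureOp cov A B X x = curvatureOp cov A B Y x := by
  have h0 : ∀ y ∈ U, cov X y = cov Y y := fun y hy ↦
    cov.isCovariantDerivativeOn.congr_of_eqOn (hX.mdifferentiableAt hy) (hY.mdifferentiableAt hy)
      (hX.1.mem_nhds hy) hXY
  have key : ∀ C : (∀ y : M, TangentSpace 𝓘(ℝ, E) y),
      ContMDiffAt 𝓘(ℝ, E) (𝓘(ℝ, E).prod 𝓘(ℝ, E)) ∞ (fun y ↦ TotalSpace.mk' E y (C y)) x →
      cov (fun y ↦ cov X y (C y)) x = cov (fun y ↦ cov Y y (C y)) x := fun C hC ↦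
    cov.isCovariantDerivativeOn.congr_of_eqOn (mdifferentiableAt_cov_apply cov hX hx hC)
      (mdifferentiableAt_cov_apply cov hY hx hC) (hX.1.mem_nhds hx)
      (fun y hy ↦ by rw [h0 y hy])
  simp only [curvatureOp, key A hA, key B hB, h0 x hx]

theorem curvatureOp_add (cov : CovariantDerivative 𝓘(ℝ, E) F W)
    [CovariantDerivative.ContMDiffCovariantDerivative cov ∞] {U : Set M} {X Y : ∀ y, W y}
    (hX : IsSmoothSectionOn E F U X) (hY : IsSmoothSectionOn E F U Y) {x : M} (hx : x ∈ U)
    {A B : ∀ y : M, TangentSpace 𝓘(ℝ, E) y}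
    (hA : ContMDiffAt 𝓘(ℝ, E) (𝓘(ℝ, E).prod 𝓘(ℝ, E)) ∞ (fun y ↦ TotalSpace.mk' E y (A y)) x)
    (hB : ContMDiffAt 𝓘(ℝ, E) (𝓘(ℝ, E).prod 𝓘(ℝ, E)) ∞ (fun y ↦ TotalSpace.mk' E y (B y)) x) :
    curvatureOp cov A B (X + Y) x = curvatureOp cov A B X x + curvatureOp cov A B Y x := by
  have hXY : IsSmoothSectionOn E F U (X + Y) := ⟨hX.1, hX.2.add_section hY.2⟩
  have key : ∀ C : (∀ y : M, TangentSpace 𝓘(ℝ, E) y),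
      ContMDiffAt 𝓘(ℝ, E) (𝓘(ℝ, E).prod 𝓘(ℝ, E)) ∞ (fun y ↦ TotalSpace.mk' E y (C y)) x →
      cov (fun y ↦ cov (X + Y) y (C y)) x
        = cov (fun y ↦ cov X y (C y)) x + cov (fun y ↦ cov Y y (C y)) x := by
    intro C hC
    have h1 := mdifferentiableAt_cov_apply cov hX hx hC
    have h2 := mdifferentiableAt_cov_apply cov hY hx hC
    rw [← cov.isCovariantDerivativeOnUniv.add h1 h2]
    refine cov.isCovariantDerivativeOnUniv.congr_of_eventuallyEq
      (mdifferentiableAt_cov_apply cov hXY hx hC) (mdifferentiableAt_add_section h1 h2) Filter.univ_mem ?_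
    filter_upwards [hX.1.mem_nhds hx] with y hy
    rw [cov.isCovariantDerivativeOnUniv.add (hX.mdifferentiableAt hy) (hY.mdifferentiableAt hy)]
    rfl
  simp only [curvatureOp, key A hA, key B hB, cov.isCovariantDerivativeOnUniv.add
    (hX.mdifferentiableAt hx) (hY.mdifferentiableAt hx), add_apply]
  abel

theorem curvatureOp_smul (cov : CovariantDerivative 𝓘(ℝ, E) F W)
    [CovariantDerivative.ContMDiffCovariantDerivative cov ∞] {U : Set M} {X : ∀ y, W y} (a : ℝ)
    (hX : IsSmoothSectionOn E F U X) {x : M} (hx : x ∈ U)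
    {A B : ∀ y : M, TangentSpace 𝓘(ℝ, E) y}
    (hA : ContMDiffAt 𝓘(ℝ, E) (𝓘(ℝ, E).prod 𝓘(ℝ, E)) ∞ (fun y ↦ TotalSpace.mk' E y (A y)) x)
    (hB : ContMDiffAt 𝓘(ℝ, E) (𝓘(ℝ, E).prod 𝓘(ℝ, E)) ∞ (fun y ↦ TotalSpace.mk' E y (B y)) x) :
    curvatureOp cov A B (a • X) x = a • curvatureOp cov A B X x := by
  have haX : IsSmoothSectionOn E F U (a • X) := ⟨hX.1, hX.2.const_smul_section⟩
  have key : ∀ C : (∀ y : M, TangentSpace 𝓘(ℝ, E) y),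
      ContMDiffAt 𝓘(ℝ, E) (𝓘(ℝ, E).prod 𝓘(ℝ, E)) ∞ (fun y ↦ TotalSpace.mk' E y (C y)) x →
      cov (fun y ↦ cov (a • X) y (C y)) x = a • cov (fun y ↦ cov X y (C y)) x := by
    intro C hC
    have h1 := mdifferentiableAt_cov_apply cov hX hx hC
    rw [← cov.isCovariantDerivativeOnUniv.smul_const a h1]
    refine cov.isCovariantDerivativeOnUniv.congr_of_eventuallyEq
      (mdifferentiableAt_cov_apply cov haX hx hC) (mdifferentiableAt_const.smul_section h1) Filter.univ_mem ?_
    filter_upwards [hX.1.mem_nhds hx] with y hy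
    rw [cov.isCovariantDerivativeOnUniv.smul_const a (hX.mdifferentiableAt hy)]
    rfl
  simp only [curvatureOp, key A hA, key B hB, cov.isCovariantDerivativeOnUniv.smul_const a
    (hX.mdifferentiableAt hx), smul_apply, smul_sub]

theorem curvature_add (cov : CovariantDerivative 𝓘(ℝ, E) F W)
    [CovariantDerivative.ContMDiffCovariantDerivative cov ∞] (x : M)
    (u v : TangentSpace 𝓘(ℝ, E) x) (w w' : W x) :
    curvature cov x u v (w + w') = curvature cov x u v w + curvature cov x u v w' := by
  have hx := FiberBundle.mem_baseSet_trivializationAt' (F := F) (E := W) x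
  have hw := isSmoothSectionOn_extend (E := E) (F := F) w
  have hw' := isSmoothSectionOn_extend (E := E) (F := F) w'
  have hu := FiberBundle.contMDiffAt_extend 𝓘(ℝ, E) E (k := ∞) u
  have hv := FiberBundle.contMDiffAt_extend 𝓘(ℝ, E) E (k := ∞) v
  exact (curvatureOp_congr cov (isSmoothSectionOn_extend (w + w')) ⟨hw.1, hw.2.add_section hw'.2⟩
    hx (fun y hy ↦ extend_add w w' hy) hu hv).trans (curvatureOp_add cov hw hw' hx hu hv)

theorem curvature_smul (cov : CovariantDerivative 𝓘(ℝ, E) F W)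
    [CovariantDerivative.ContMDiffCovariantDerivative cov ∞] (x : M)
    (u v : TangentSpace 𝓘(ℝ, E) x) (a : ℝ) (w : W x) :
    curvature cov x u v (a • w) = a • curvature cov x u v w := by
  have hx := FiberBundle.mem_baseSet_trivializationAt' (F := F) (E := W) x
  have hw := isSmoothSectionOn_extend (E := E) (F := F) w
  have hu := FiberBundle.contMDiffAt_extend 𝓘(ℝ, E) E (k := ∞) u
  have hv := FiberBundle.contMDiffAt_extend 𝓘(ℝ, E) E (k := ∞) v
  exact (curvatureOp_congr cov (isSmoothSectionOn_extend (a • w)) ⟨hw.1, hw.2.const_smul_section⟩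
    hx (fun y hy ↦ extend_smul a w hy) hu hv).trans (curvatureOp_smul cov a hw hx hu hv)

end CurvatureLemmas

/-! ### The derived flag -/

section Flag

/-- The fibre at `x` of `{w ∈ W | R(·,·)w = 0}`. -/
def curvatureKernel [FiniteDimensional ℝ E] [T2Space M] [IsManifold 𝓘(ℝ, E) ∞ M]
    [VectorBundle ℝ F W] [ContMDiffVectorBundle ∞ F W 𝓘(ℝ, E)]
    (cov : CovariantDerivative 𝓘(ℝ, E) F W) [CovariantDerivative.ContMDiffCovariantDerivative cov ∞] (x : M) :
    Submodule ℝ (W x) where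
  carrier := {w | ∀ u v : TangentSpace 𝓘(ℝ, E) x, curvature cov x u v w = 0}
  add_mem' := fun {w w'} hw hw' u v ↦ by rw [curvature_add, hw u v, hw' u v, add_zero]
  zero_mem' := fun u v ↦ by simpa using curvature_smul cov x u v 0 (0 : W x)
  smul_mem' := fun a w hw u v ↦ by rw [curvature_smul, hw u v, smul_zero]

variable [VectorBundle ℝ F W]

variable (E F) in
/-- The fibre at `x` of `𝒮(S)`: the vectors of `S` through which there passes a smooth local
section of `W` with values in `S`. -/
def smoothPart (S : ∀ y, Submodule ℝ (W y)) (x : M) : Submodule ℝ (W x) where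
  carrier := {w | ∃ (U : Set M) (X : ∀ y, W y),
    x ∈ U ∧ IsSmoothSectionInOn E F S U X ∧ X x = w}
  add_mem' := by
    rintro _ _ ⟨U, X, hxU, hX, rfl⟩ ⟨U', Y, hxU', hY, rfl⟩
    exact ⟨U ∩ U', X + Y, ⟨hxU, hxU'⟩, hX.add hY, rfl⟩
  zero_mem' := ⟨Set.univ, 0, trivial, .zero S, rfl⟩
  smul_mem' := by
    rintro a _ ⟨U, X, hxU, hX, rfl⟩
    exact ⟨U, a • X, hxU, hX.const_smul a, rfl⟩

/-- The class of `∇X` modulo `S`, at the point `x`, as a linear map `T_x M → W_x / S_x`. For a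
local section `X` with values in `S` this is the second fundamental 1-form `α_S` of `S` applied to
the vector `X x`. -/
def secondFundamentalForm (cov : CovariantDerivative 𝓘(ℝ, E) F W) (S : ∀ y, Submodule ℝ (W y))
    (X : ∀ y, W y) (x : M) : TangentSpace 𝓘(ℝ, E) x →ₗ[ℝ] W x ⧸ S x :=
  (S x).mkQ ∘ₗ (cov X x).toLinearMap

/-- The fibre at `x` of the kernel of the second fundamental 1-form `α_S` of `S`: the vectors `w`
of `S` which are the value at `x` of a local section `X` of `S` with `(∇X mod S)(x) = 0`. -/
def secondFundamentalKernel (cov : CovariantDerivative 𝓘(ℝ, E) F W)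
    (S : ∀ y, Submodule ℝ (W y)) (x : M) : Submodule ℝ (W x) where
  carrier := {w | ∃ (U : Set M) (X : ∀ y, W y), x ∈ U ∧ IsSmoothSectionInOn E F S U X ∧
    X x = w ∧ secondFundamentalForm cov S X x = 0}
  add_mem' := by
    rintro _ _ ⟨U, X, hxU, hX, rfl, h⟩ ⟨U', Y, hxU', hY, rfl, h'⟩
    refine ⟨U ∩ U', X + Y, ⟨hxU, hxU'⟩, hX.add hY, rfl, ?_⟩
    have h1 : secondFundamentalForm cov S (X + Y) x
        = secondFundamentalForm cov S X x + secondFundamentalForm cov S Y x := by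
      rw [secondFundamentalForm, cov.isCovariantDerivativeOnUniv.add
        (hX.1.mdifferentiableAt hxU) (hY.1.mdifferentiableAt hxU')]
      exact LinearMap.comp_add _ _ _
    rw [h1, h, h', add_zero]
  zero_mem' := ⟨Set.univ, 0, trivial, .zero S, rfl, by
    rw [secondFundamentalForm, cov.zero]; exact LinearMap.comp_zero _⟩
  smul_mem' := by
    rintro a _ ⟨U, X, hxU, hX, rfl, h⟩
    refine ⟨U, a • X, hxU, hX.const_smul a, rfl, ?_⟩
    have h1 : secondFundamentalForm cov S (a • X) x = a • secondFundamentalForm cov S X x := by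
      rw [secondFundamentalForm, cov.isCovariantDerivativeOnUniv.smul_const a
        (hX.1.mdifferentiableAt hxU)]
      exact LinearMap.comp_smul _ _ _
    rw [h1, h, smul_zero]

variable [FiniteDimensional ℝ E] [T2Space M] [IsManifold 𝓘(ℝ, E) ∞ M]
  [ContMDiffVectorBundle ∞ F W 𝓘(ℝ, E)]
  (cov : CovariantDerivative 𝓘(ℝ, E) F W) [CovariantDerivative.ContMDiffCovariantDerivative cov ∞]

/-- The derived flag `W⁽⁰⁾ ⊇ W⁽¹⁾ ⊇ ⋯` of subsets of `W`: `W⁽ⁱ⁾ = 𝒮(V⁽ⁱ⁾)`, where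
`V⁽⁰⁾ = {w | R(·,·)w = 0}` and `V⁽ⁱ⁺¹⁾` is the kernel of the second fundamental 1-form of
`W⁽ⁱ⁾`. -/
def derivedFlag : ℕ → ∀ y : M, Submodule ℝ (W y)
  | 0 => smoothPart E F (curvatureKernel cov)
  | i + 1 => smoothPart E F (secondFundamentalKernel cov (derivedFlag i))

/-- The fibre at `y` of the maximal flat subset `W̃` of `W`, the limit of the decreasing derived
flag (so `W̃ = W⁽ᵏ⁾` as soon as `W⁽ˡ⁾ = W⁽ᵏ⁾` for all `l ≥ k`). -/
def maximalFlat (y : M) : Submodule ℝ (W y) := ⨅ i, derivedFlag cov i y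

variable (E F) in
/-- The part over the open set `U` of a subset `S` of `W` with linear fibres is a smooth vector
bundle over `U` (a smooth subbundle of `W` over `U`): near every point of `U` there is a smooth
local frame of `S`. -/
def IsSmoothSubbundleOn (S : ∀ y, Submodule ℝ (W y)) (U : Set M) : Prop :=
  ∀ y ∈ U, ∃ (U' : Set M) (n : ℕ) (X : Fin n → ∀ z, W z), y ∈ U' ∧ U' ⊆ U ∧
    (∀ j, IsSmoothSectionOn E F U' (X j)) ∧ IsOpen U' ∧
    ∀ z ∈ U', LinearIndependent ℝ (fun j ↦ X j z) ∧
      Submodule.span ℝ (Set.range fun j ↦ X j z) = S z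

/-- The connection is regular at `x`: over some open neighbourhood of `x`, the subset `W̃` is a
vector bundle. -/
def IsRegularAt (x : M) : Prop :=
  ∃ U : Set M, IsOpen U ∧ x ∈ U ∧ IsSmoothSubbundleOn E F (maximalFlat cov) U

end Flag

end ParallelSections

end

/-!
Write `W̃` for the maximal flat subset. Existence and maximality rest on one fact: near a regular
point `W̃` is a flat subbundle that the connection preserves.

*Parallel sections lie in `W̃`.* A parallel section `X` is annihilated by the curvature, since
second derivatives commute; it is then a smooth section of the first member of the flag, and
because `∇X = 0` it passes, by induction, through all the others
(`IsParallelOn.mem_maximalFlat`). It is determined near `x` by its value at `x`, as along each ray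
from `x` in a chart it solves a linear differential equation
(`IsParallelOn.eventually_eq_zero`). So evaluation at `x` maps parallel germs injectively into
`W̃_x`.

*`W̃` is preserved by the connection.* Flatness of `W̃` is immediate, but the flag may stabilize
at different stages at different points, so that near `x` the set `W̃` need not be known to equal
one member of the flag. However, the rank of each member is lower semicontinuous, while the rank of
`W̃` is constant near a regular point. Hence the set of points where the `k`-th member has the rank
of `W̃` is closed, and by Baire's theorem the interiors of these sets have dense union
(`exists_eventually_derivedFlag_eq`). At a point of that union, every vector of `W̃` extends to a
section of `W̃` whose covariant derivative lies in `W̃`; in terms of smooth projections `Q` onto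
`W̃` in coordinates, this reads `dQ v (Q f) + (1 - Q) (θ v (Q f)) = 0`, with `θ` the connection
form (`fderiv_projection_eq_zero`). The equation is a closed condition, so it holds everywhere near
`x` (`projection_parallel`).

*Parallel sections through the vectors of `W̃_x`.* In coordinates, a vector of `W̃_x` is transported
along the rays from `x`. By the equation for `Q` the transported vectors stay in `W̃`, so the
curvature annihilates them, and a Grönwall estimate shows that the function obtained in this way is
differentiable with derivative `-θ a`, that is, parallel (`hasFDerivAt_radial_transport`,
`exists_parallel`). The estimate takes the place of a theorem on smooth dependence of solutions on
parameters, and smoothness follows by bootstrapping.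
-/

set_option maxSynthPendingDepth 3

noncomputable section

namespace ParallelSections

/-! ### Linear differential equations on the unit interval -/

section LinearODE

open Set

variable {F : Type*} [NormedAddCommGroup F] [NormedSpace ℝ F]

/-- A linear equation on the unit interval has a solution; the bound on the coefficients lets one
application of Picard-Lindelöf, on the ball of radius `‖a₀‖` around `a₀`, cover the whole interval. -/
theorem exists_hasDerivWithinAt_linear [CompleteSpace F] {B : ℝ → F →L[ℝ] F}
    (hB : ContinuousOn B (Icc 0 1)) (hn : ∀ t ∈ Icc (0 : ℝ) 1, ‖B t‖ ≤ 1 / 2) (a₀ : F) :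
    ∃ a : ℝ → F, a 0 = a₀ ∧
      ∀ t ∈ Icc (0 : ℝ) 1, HasDerivWithinAt a (B t (a t)) (Icc 0 1) t := by
  have h0 : (0 : ℝ) ∈ Icc (0 : ℝ) 1 := by simp
  have hpl : IsPicardLindelof (fun t f ↦ B t f) (⟨0, h0⟩ : Icc (0 : ℝ) 1) a₀ ‖a₀‖₊ 0 ‖a₀‖₊ 1 := by
    refine ⟨fun t ht ↦ ?_, fun f _ ↦ hB.clm_apply continuousOn_const, fun t ht f hf ↦ ?_, by simp⟩
    · refine ((B t).lipschitz.weaken ?_).lipschitzOnWith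
      exact_mod_cast (hn t ht).trans (by norm_num)
    · have h1 : ‖f‖ ≤ 2 * ‖a₀‖ := by
        have := norm_le_norm_add_norm_sub' f a₀
        have h2 : ‖f - a₀‖ ≤ ‖a₀‖ := by simpa [dist_eq_norm] using hf
        linarith
      have := (B t).le_of_opNorm_le (hn t ht) f
      simp only [coe_nnnorm]
      linarith
  exact hpl.exists_eq_forall_mem_Icc_hasDerivWithinAt₀

theorem eq_zero_of_hasDerivWithinAt_linear {B : ℝ → F →L[ℝ] F}
    (hB : ContinuousOn B (Icc 0 1)) {a : ℝ → F} (h0 : a 0 = 0)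
    (ha : ∀ t ∈ Icc (0 : ℝ) 1, HasDerivWithinAt a (B t (a t)) (Icc 0 1) t) :
    ∀ t ∈ Icc (0 : ℝ) 1, a t = 0 := by
  obtain ⟨K, hK⟩ := isCompact_Icc.exists_bound_of_continuousOn hB
  refine eq_zero_of_abs_deriv_le_mul_abs_self_of_eq_zero_right (K := K)
    (fun t ht ↦ (ha t ht).continuousWithinAt) (fun t ht ↦ ?_) h0
    (fun t ht ↦ (B t).le_of_opNorm_le (hK t ⟨ht.1, ht.2.le⟩) _)
  exact (ha t ⟨ht.1, ht.2.le⟩).mono_of_mem_nhdsWithin (Icc_mem_nhdsGE_of_mem ht)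

end LinearODE

/-! ### Parallel functions for a connection form on a vector space -/

section ConnectionForm

open Set Metric

variable {E F : Type*} [NormedAddCommGroup E] [NormedSpace ℝ E]
  [NormedAddCommGroup F] [NormedSpace ℝ F]

/-- The curvature `dθ + θ ∧ θ` of the connection `d + θ` on the trivial bundle `E × F`, at the point
`z` and on the vectors `u` and `v`. -/
def curvatureForm (θ : E → E →L[ℝ] F →L[ℝ] F) (z u v : E) : F →L[ℝ] F :=
  fderiv ℝ θ z u v - fderiv ℝ θ z v u + (θ z u ∘L θ z v - θ z v ∘L θ z u)

theorem hasDerivAt_ray (z₀ x : E) (t : ℝ) : HasDerivAt (fun t : ℝ ↦ z₀ + t • x) x t := by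
  simpa using ((hasDerivAt_id t).smul_const x).const_add z₀

theorem ray_mem_ball {z₀ x : E} {ρ : ℝ} (hx : x ∈ ball (0 : E) ρ) {t : ℝ} (ht : t ∈ Icc (0 : ℝ) 1) :
    z₀ + t • x ∈ ball z₀ ρ := by
  simp only [mem_ball, dist_self_add_left, dist_zero_right] at hx ⊢
  rw [norm_smul, Real.norm_of_nonneg ht.1]
  exact (mul_le_of_le_one_left (norm_nonneg _) ht.2).trans_lt hx

/-- A parallel function on a ball that vanishes at the centre vanishes on the ball: along each ray
from the centre it solves a linear differential equation. -/
theorem eq_zero_of_parallel {θ : E → E →L[ℝ] F →L[ℝ] F} {a : E → F} {z₀ : E} {ρ : ℝ}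
    (hθ : ContinuousOn θ (ball z₀ ρ)) (ha : ∀ z ∈ ball z₀ ρ, DifferentiableAt ℝ a z)
    (hpar : ∀ z ∈ ball z₀ ρ, ∀ v, fderiv ℝ a z v + θ z v (a z) = 0) (h0 : a z₀ = 0) :
    ∀ z ∈ ball z₀ ρ, a z = 0 := by
  intro z hz
  have hx : z - z₀ ∈ ball (0 : E) ρ := by simpa [dist_eq_norm] using hz
  have hray := fun t ht ↦ ray_mem_ball (z₀ := z₀) hx (t := t) ht
  have hc : ContinuousOn (fun t : ℝ ↦ z₀ + t • (z - z₀)) (Icc 0 1) := by fun_prop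
  have hB : ContinuousOn (fun t : ℝ ↦ -θ (z₀ + t • (z - z₀)) (z - z₀)) (Icc 0 1) :=
    ((hθ.comp hc hray).clm_apply continuousOn_const).neg
  have := eq_zero_of_hasDerivWithinAt_linear hB (a := fun t ↦ a (z₀ + t • (z - z₀)))
    (by simpa using h0) (fun t ht ↦ ?_) 1 (by simp)
  · simpa using this
  · have h1 := (ha _ (hray t ht)).hasFDerivAt.comp_hasDerivAt t (hasDerivAt_ray z₀ (z - z₀) t)
    rw [eq_neg_of_add_eq_zero_left (hpar _ (hray t ht) (z - z₀))] at h1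
    exact h1.hasDerivWithinAt

/-- Quantitative control of a `C²` map near a point: bounds for the map, its derivative, its
increments and the remainder of its first order expansion. -/
theorem exists_bounds_of_contDiffAt {G : Type*} [NormedAddCommGroup G] [NormedSpace ℝ G]
    {θ : E → G} {z₀ : E} (hθ : ContDiffAt ℝ 2 θ z₀) :
    ∃ K, 0 ≤ K ∧ ∃ ρ > 0, (∀ z ∈ ball z₀ ρ, DifferentiableAt ℝ θ z ∧ ‖θ z‖ ≤ K ∧
      ‖fderiv ℝ θ z‖ ≤ K) ∧ ∀ z ∈ ball z₀ ρ, ∀ z' ∈ ball z₀ ρ, ‖θ z' - θ z‖ ≤ K * ‖z' - z‖ ∧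
      ‖θ z' - θ z - fderiv ℝ θ z (z' - z)‖ ≤ K * ‖z' - z‖ ^ 2 := by
  have hD : ContDiffAt ℝ 1 (fderiv ℝ θ) z₀ := hθ.fderiv_right (by norm_num)
  obtain ⟨L, s, hs, hL⟩ := hD.exists_lipschitzOnWith
  have h1 : ∀ᶠ z in 𝓝 z₀, ‖θ z‖ < ‖θ z₀‖ + 1 :=
    hθ.continuousAt.norm.eventually_lt continuousAt_const (by simp)
  have h2 : ∀ᶠ z in 𝓝 z₀, ‖fderiv ℝ θ z‖ < ‖fderiv ℝ θ z₀‖ + 1 :=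
    hD.continuousAt.norm.eventually_lt continuousAt_const (by simp)
  have h3 : ∀ᶠ z in 𝓝 z₀, DifferentiableAt ℝ θ z :=
    (hθ.eventually (by simp)).mono fun z hz ↦ hz.differentiableAt (by simp)
  obtain ⟨ρ, hρ, hball⟩ := Metric.eventually_nhds_iff_ball.1 (h1.and (h2.and (h3.and hs)))
  set K := (‖θ z₀‖ + 1) + (‖fderiv ℝ θ z₀‖ + 1) + L with hK
  have hL0 : (0 : ℝ) ≤ L := L.2
  have hn1 := norm_nonneg (θ z₀)
  have hn2 := norm_nonneg (fderiv ℝ θ z₀)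
  refine ⟨K, by positivity, ρ, hρ, fun z hz ↦ ⟨(hball z hz).2.2.1, ?_, ?_⟩,
    fun z hz z' hz' ↦ ⟨?_, ?_⟩⟩
  · linarith [(hball z hz).1]
  · linarith [(hball z hz).2.1]
  · refine (convex_ball z₀ ρ).norm_image_sub_le_of_norm_fderiv_le (𝕜 := ℝ)
      (fun y hy ↦ (hball y hy).2.2.1) (fun y hy ↦ ?_) hz hz'
    linarith [(hball y hy).2.1]
  · have hseg : segment ℝ z z' ⊆ ball z₀ ρ := (convex_ball z₀ ρ).segment_subset hz hz'
    have := (convex_segment z z').norm_image_sub_le_of_norm_hasFDerivWithin_le'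
      (f := θ) (f' := fderiv ℝ θ) (φ := fderiv ℝ θ z) (C := L * ‖z' - z‖)
      (fun y hy ↦ (hball y (hseg hy)).2.2.1.hasFDerivAt.hasFDerivWithinAt) (fun y hy ↦ ?_)
      (left_mem_segment ℝ z z') (right_mem_segment ℝ z z')
    · refine this.trans ?_
      rw [mul_assoc, ← sq]
      gcongr
      linarith
    · refine (hL.norm_sub_le (hball y (hseg hy)).2.2.2 (hball z hz).2.2.2).trans ?_
      gcongr
      exact norm_sub_le_of_mem_segment hy

end ConnectionForm

/-! ### Existence of parallel functions -/

section ParallelFunctions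

open Set Metric

variable {E F : Type*} [NormedAddCommGroup E] [NormedSpace ℝ E]
  [NormedAddCommGroup F] [NormedSpace ℝ F] {θ : E → E →L[ℝ] F →L[ℝ] F}

/-- Radial parallel transport from `z₀` of a fixed vector is parallel, provided the curvature kills
the transported vectors. For a small vector `h` the curve
`t ↦ a x t - t • θ (z₀ + t • x) h (a x t)` solves the transport equation in the direction `x + h` up
to an error `O(‖h‖²)`, precisely because the curvature vanishes on `a x t`; Grönwall's inequality
then compares it with `a (x + h)`. -/
theorem hasFDerivAt_radial_transport {z₀ : E} {ρ K : ℝ} (hK : 0 ≤ K) (hρ : ρ ≤ 1)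
    (hKρ : K * ρ ≤ 1 / 2)
    (hb : ∀ z ∈ ball z₀ ρ, DifferentiableAt ℝ θ z ∧ ‖θ z‖ ≤ K ∧ ‖fderiv ℝ θ z‖ ≤ K)
    (hb' : ∀ z ∈ ball z₀ ρ, ∀ z' ∈ ball z₀ ρ, ‖θ z' - θ z‖ ≤ K * ‖z' - z‖ ∧
      ‖θ z' - θ z - fderiv ℝ θ z (z' - z)‖ ≤ K * ‖z' - z‖ ^ 2)
    {a : E → ℝ → F} {a₀ : F} (ha₀ : ∀ x ∈ ball (0 : E) ρ, a x 0 = a₀)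
    (ha : ∀ x ∈ ball (0 : E) ρ, ∀ t ∈ Icc (0 : ℝ) 1,
      HasDerivWithinAt (a x) (-θ (z₀ + t • x) x (a x t)) (Icc 0 1) t)
    (hflat : ∀ x ∈ ball (0 : E) ρ, ∀ t ∈ Icc (0 : ℝ) 1, ∀ u v,
      curvatureForm θ (z₀ + t • x) u v (a x t) = 0) {x : E} (hx : x ∈ ball (0 : E) ρ) :
    HasFDerivAt (fun x ↦ a x 1) (-(θ (z₀ + x)).flip (a x 1)) x := by
  obtain ⟨C, hC⟩ := isCompact_Icc.exists_bound_of_continuousOn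
    (fun t ht ↦ (ha x hx t ht).continuousWithinAt)
  have hC0 : 0 ≤ C := (norm_nonneg _).trans (hC 0 (by simp))
  have hx1 : ‖x‖ ≤ ρ := (mem_ball_zero_iff.1 hx).le
  set D := (2 * K + 2 * K ^ 2) * C with hD
  have hD0 : 0 ≤ D := by positivity
  -- the error of the first order approximation is quadratic in `h`
  have key : ∀ h : E, x + h ∈ ball (0 : E) ρ →
      ‖a (x + h) 1 - a x 1 + θ (z₀ + x) h (a x 1)‖ ≤ D * (Real.exp 1 - 1) * ‖h‖ ^ 2 := by
    intro h hxh
    have hxh1 : ‖x + h‖ ≤ ρ := (mem_ball_zero_iff.1 hxh).le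
    have hderiv : ∀ t ∈ Icc (0 : ℝ) 1, HasDerivWithinAt
        (fun t ↦ a x t - t • θ (z₀ + t • x) h (a x t) - a (x + h) t)
        (-θ (z₀ + t • x) x (a x t) - (θ (z₀ + t • x) h (a x t)
          + t • (fderiv ℝ θ (z₀ + t • x) x h (a x t)
            + θ (z₀ + t • x) h (-θ (z₀ + t • x) x (a x t))))
          + θ (z₀ + t • (x + h)) (x + h) (a (x + h) t)) (Icc 0 1) t := by
      intro t ht
      have h1 : HasDerivWithinAt (fun t : ℝ ↦ θ (z₀ + t • x)) (fderiv ℝ θ (z₀ + t • x) x)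
          (Icc 0 1) t :=
        ((hb _ (ray_mem_ball hx ht)).1.hasFDerivAt.comp_hasDerivAt t
          (hasDerivAt_ray z₀ x t)).hasDerivWithinAt
      have h2 := (h1.clm_apply (hasDerivWithinAt_const t _ h)).clm_apply (ha x hx t ht)
      have h3 := ((ha x hx t ht).sub ((hasDerivWithinAt_id t _).smul h2)).sub (ha _ hxh t ht)
      refine h3.congr_deriv ?_
      simp only [map_zero, add_zero, id, one_smul, sub_neg_eq_add]
      abel
    have hbound : ∀ t ∈ Icc (0 : ℝ) 1,
        ‖-θ (z₀ + t • x) x (a x t) - (θ (z₀ + t • x) h (a x t)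
          + t • (fderiv ℝ θ (z₀ + t • x) x h (a x t)
            + θ (z₀ + t • x) h (-θ (z₀ + t • x) x (a x t))))
          + θ (z₀ + t • (x + h)) (x + h) (a (x + h) t)‖
        ≤ 1 * ‖a x t - t • θ (z₀ + t • x) h (a x t) - a (x + h) t‖ + D * ‖h‖ ^ 2 := by
      intro t ht
      have hz := ray_mem_ball (z₀ := z₀) hx ht
      have hz' := ray_mem_ball (z₀ := z₀) hxh ht
      have hfl := hflat x hx t ht h x
      have hat := hC t ht
      obtain ⟨-, hθ, hdθ⟩ := hb _ hz
      obtain ⟨-, hθ', -⟩ := hb _ hz'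
      obtain ⟨hi, hr⟩ := hb' _ hz _ hz'
      have hdiff : z₀ + t • (x + h) - (z₀ + t • x) = t • h := by rw [smul_add]; abel
      have hth : ‖t • h‖ ≤ ‖h‖ := by
        rw [norm_smul, Real.norm_of_nonneg ht.1]
        exact mul_le_of_le_one_left (norm_nonneg _) ht.2
      rw [hdiff] at hi hr
      set z := z₀ + t • x
      set z' := z₀ + t • (x + h)
      set b := a x t
      set b' := a (x + h) t
      set T := fderiv ℝ θ z
      -- the remainder in the equation, after cancellation of the curvature
      have hsplit : -θ z x b - (θ z h b + t • (T x h b + θ z h (-θ z x b))) + θ z' (x + h) b'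
          = -θ z' (x + h) (b - t • θ z h b - b') + (t • T h h b
            + (θ z' - θ z - T (t • h)) (x + h) b - t • θ z h (θ z h b)
            - t • (θ z' - θ z) (x + h) (θ z h b)) := by
        have h0 : t • (T h x b - T x h b + (θ z h (θ z x b) - θ z x (θ z h b))) = 0 := by
          rw [← smul_zero t, ← hfl]
          simp [curvatureForm, T]
        rw [← sub_eq_zero, ← h0]
        simp only [map_add, map_sub, map_smul, map_neg, add_apply, sub_apply, smul_apply]
        module
      rw [hsplit]
      have e1 : ‖θ z' (x + h) (b - t • θ z h b - b')‖ ≤ 1 * ‖b - t • θ z h b - b'‖ := by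
        refine (θ z' (x + h)).le_of_opNorm_le (((θ z').le_of_opNorm_le hθ' _).trans ?_) _
        nlinarith
      have nt : ∀ f : F, ‖t • f‖ ≤ ‖f‖ := fun f ↦ by
        rw [norm_smul, Real.norm_of_nonneg ht.1]
        exact mul_le_of_le_one_left (norm_nonneg _) ht.2
      have nθ : ∀ f : F, ‖θ z h f‖ ≤ K * ‖h‖ * ‖f‖ := fun f ↦
        (θ z h).le_of_opNorm_le ((θ z).le_of_opNorm_le hθ _) _
      have e2 : ‖t • T h h b‖ ≤ K * ‖h‖ * ‖h‖ * C := by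
        refine (nt _).trans (((T h h).le_of_opNorm_le
          ((T h).le_of_opNorm_le (T.le_of_opNorm_le hdθ h) h) _).trans ?_)
        gcongr
      have e3 : ‖(θ z' - θ z - T (t • h)) (x + h) b‖ ≤ K * ‖h‖ ^ 2 * 1 * C := by
        refine (ContinuousLinearMap.le_of_opNorm_le _
          (ContinuousLinearMap.le_of_opNorm_le _ hr _) _).trans ?_
        gcongr
        exact hxh1.trans hρ
      have e4 : ‖t • θ z h (θ z h b)‖ ≤ K * ‖h‖ * (K * ‖h‖ * C) := by
        refine (nt _).trans ((nθ _).trans ?_)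
        gcongr
        exact (nθ _).trans (by gcongr)
      have e5 : ‖t • (θ z' - θ z) (x + h) (θ z h b)‖ ≤ K * ‖h‖ * 1 * (K * ‖h‖ * C) := by
        refine (nt _).trans ((ContinuousLinearMap.le_of_opNorm_le _
          (ContinuousLinearMap.le_of_opNorm_le _ hi _) _).trans ?_)
        gcongr
        · exact hxh1.trans hρ
        · exact (nθ _).trans (by gcongr)
      have n1 := norm_add_le (-θ z' (x + h) (b - t • θ z h b - b')) (t • T h h b
            + (θ z' - θ z - T (t • h)) (x + h) b - t • θ z h (θ z h b)
            - t • (θ z' - θ z) (x + h) (θ z h b))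
      have n2 := norm_sub_le (t • T h h b + (θ z' - θ z - T (t • h)) (x + h) b
        - t • θ z h (θ z h b)) (t • (θ z' - θ z) (x + h) (θ z h b))
      have n3 := norm_sub_le (t • T h h b + (θ z' - θ z - T (t • h)) (x + h) b)
        (t • θ z h (θ z h b))
      have n4 := norm_add_le (t • T h h b) ((θ z' - θ z - T (t • h)) (x + h) b)
      rw [norm_neg] at n1
      have : D * ‖h‖ ^ 2 = K * ‖h‖ * ‖h‖ * C + K * ‖h‖ ^ 2 * 1 * C + K * ‖h‖ * (K * ‖h‖ * C)
          + K * ‖h‖ * 1 * (K * ‖h‖ * C) := by rw [hD]; ring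
      linarith
    have hg := norm_le_gronwallBound_of_norm_deriv_right_le (δ := 0) (K := 1) (ε := D * ‖h‖ ^ 2)
      (fun t ht ↦ (hderiv t ht).continuousWithinAt)
      (fun t ht ↦ (hderiv t ⟨ht.1, ht.2.le⟩).mono_of_mem_nhdsWithin (Icc_mem_nhdsGE_of_mem ht))
      (by simp [ha₀ x hx, ha₀ _ hxh]) (fun t ht ↦ hbound t ⟨ht.1, ht.2.le⟩) 1 (by simp)
    rw [gronwallBound_of_K_ne_0 one_ne_zero] at hg
    simp only [one_smul, sub_zero, zero_mul, div_one, mul_one, zero_add] at hg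
    rw [← norm_neg]
    convert! hg using 1
    · congr 1; abel
    · ring
  rw [hasFDerivAt_iff_isLittleO_nhds_zero]
  refine Asymptotics.IsBigO.trans_isLittleO (g := fun h : E ↦ ‖h‖ ^ 2) ?_
    (Asymptotics.isLittleO_norm_pow_id one_lt_two)
  refine Asymptotics.IsBigO.of_bound (D * (Real.exp 1 - 1)) ?_
  have hev : ∀ᶠ h in 𝓝 (0 : E), x + h ∈ ball (0 : E) ρ := by
    have : Filter.Tendsto (fun h ↦ x + h) (𝓝 (0 : E)) (𝓝 x) := by
      simpa using (continuous_const_add x).tendsto (0 : E)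
    exact this (isOpen_ball.mem_nhds hx)
  filter_upwards [hev] with h hh
  simpa using! key h hh

/-- A differentiable parallel function is smooth, by bootstrapping in `da = -θ a`. -/
theorem contDiffOn_of_parallel {a : E → F} {s : Set E} (hs : IsOpen s)
    (hθ : ContDiffOn ℝ ∞ θ s) (ha : ∀ z ∈ s, HasFDerivAt a (-(θ z).flip (a z)) z) :
    ContDiffOn ℝ ∞ a s := by
  rw [contDiffOn_infty]
  intro n
  induction n with
  | zero => exact contDiffOn_zero.2 fun z hz ↦ (ha z hz).continuousAt.continuousWithinAt
  | succ n ih =>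
    push_cast
    rw [contDiffOn_succ_iff_fderiv_of_isOpen hs]
    refine ⟨fun z hz ↦ (ha z hz).differentiableAt.differentiableWithinAt, by simp, ?_⟩
    have h1 : ContDiffOn ℝ n (fun z ↦ -(θ z).flip (a z)) s := by
      have h2 : ContDiffOn ℝ n (fun z ↦ (θ z).flip) s :=
        (ContinuousLinearMap.flipₗᵢ ℝ E F F).contDiff.comp_contDiffOn
          (hθ.of_le ENat.LEInfty.out)
      exact (h2.clm_apply ih).neg
    exact h1.congr fun z hz ↦ (ha z hz).fderiv

/-- Let `Q z` be smoothly varying projections whose ranges form a subbundle of `E × F` that is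
preserved by the connection `d + θ` and on which its curvature vanishes. Then through every vector
of the subbundle over `z₀` there passes a parallel function, on a ball that does not depend on the
vector. -/
theorem exists_parallel [CompleteSpace F] {O : Set E} (hO : IsOpen O) {z₀ : E} (hz₀ : z₀ ∈ O)
    (hθ : ContDiffOn ℝ ∞ θ O) {Q : E → F →L[ℝ] F} (hQ : ContDiffOn ℝ ∞ Q O)
    (hpar : ∀ z ∈ O, ∀ v f,
      fderiv ℝ Q z v (Q z f) + (θ z v (Q z f) - Q z (θ z v (Q z f))) = 0)
    (hflat : ∀ z ∈ O, ∀ u v f, curvatureForm θ z u v (Q z f) = 0) :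
    ∃ ρ > 0, ball z₀ ρ ⊆ O ∧ ∀ a₀, Q z₀ a₀ = a₀ → ∃ a : E → F, a z₀ = a₀ ∧
      ContDiffOn ℝ ∞ a (ball z₀ ρ) ∧ ∀ z ∈ ball z₀ ρ, ∀ v, fderiv ℝ a z v + θ z v (a z) = 0 := by
  obtain ⟨K, hK, ρ₁, hρ₁, hb, hb'⟩ := exists_bounds_of_contDiffAt
    ((hθ.contDiffAt (hO.mem_nhds hz₀)).of_le (ENat.LEInfty.out : (2 : ℕ∞ω) ≤ ∞))
  obtain ⟨ρ₂, hρ₂, hball⟩ := Metric.isOpen_iff.1 hO z₀ hz₀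
  set ρ := min (min ρ₁ ρ₂) (min 1 (1 / (2 * (K + 1)))) with hρdef
  have hρ : 0 < ρ := by positivity
  have hρ_le₁ : ρ ≤ ρ₁ := (min_le_left _ _).trans (min_le_left _ _)
  have hρ_le₂ : ρ ≤ ρ₂ := (min_le_left _ _).trans (min_le_right _ _)
  have hρ_le : ρ ≤ 1 := (min_le_right _ _).trans (min_le_left _ _)
  have hKρ : K * ρ ≤ 1 / 2 := by
    have h1 : ρ ≤ 1 / (2 * (K + 1)) := (min_le_right _ _).trans (min_le_right _ _)
    calc K * ρ ≤ (K + 1) * (1 / (2 * (K + 1))) := by gcongr; linarith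
      _ = 1 / 2 := by field_simp
  have hsub : ball z₀ ρ ⊆ O := (ball_subset_ball hρ_le₂).trans hball
  have hsub₁ : ball z₀ ρ ⊆ ball z₀ ρ₁ := ball_subset_ball hρ_le₁
  refine ⟨ρ, hρ, hsub, fun a₀ ha₀ ↦ ?_⟩
  have hray : ∀ x ∈ ball (0 : E) ρ, ∀ t ∈ Icc (0 : ℝ) 1, z₀ + t • x ∈ ball z₀ ρ :=
    fun x hx t ht ↦ ray_mem_ball hx ht
  have hrayc : ∀ x : E, ContinuousOn (fun t : ℝ ↦ z₀ + t • x) (Icc 0 1) := fun x ↦ by fun_prop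
  have hθc : ∀ x ∈ ball (0 : E) ρ, ContinuousOn (fun t : ℝ ↦ -θ (z₀ + t • x) x) (Icc 0 1) :=
    fun x hx ↦ (((hθ.continuousOn.mono hsub).comp (hrayc x) (hray x hx)).clm_apply
      continuousOn_const).neg
  have hex : ∀ x : E, ∃ a : ℝ → F, x ∈ ball (0 : E) ρ → a 0 = a₀ ∧ ∀ t ∈ Icc (0 : ℝ) 1,
      HasDerivWithinAt a (-θ (z₀ + t • x) x (a t)) (Icc 0 1) t := by
    intro x
    by_cases hx : x ∈ ball (0 : E) ρ
    · have hn : ∀ t ∈ Icc (0 : ℝ) 1, ‖-θ (z₀ + t • x) x‖ ≤ 1 / 2 := fun t ht ↦ by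
        have hx1 : ‖x‖ ≤ ρ := (mem_ball_zero_iff.1 hx).le
        rw [norm_neg]
        refine ((θ _).le_of_opNorm_le (hb _ (hsub₁ (hray x hx t ht))).2.1 x).trans ?_
        exact (mul_le_mul_of_nonneg_left hx1 hK).trans hKρ
      obtain ⟨a, h0, h1⟩ := exists_hasDerivWithinAt_linear (hθc x hx) hn a₀
      exact ⟨a, fun _ ↦ ⟨h0, h1⟩⟩
    · exact ⟨0, fun h ↦ absurd h hx⟩
  choose a ha using hex
  -- the transported vectors stay in the subbundle
  have hQa : ∀ x ∈ ball (0 : E) ρ, ∀ t ∈ Icc (0 : ℝ) 1, Q (z₀ + t • x) (a x t) = a x t := by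
    intro x hx
    have hQc : ContinuousOn (fun t : ℝ ↦ Q (z₀ + t • x)) (Icc 0 1) :=
      (hQ.continuousOn.mono hsub).comp (hrayc x) (hray x hx)
    have hDQc : ContinuousOn (fun t : ℝ ↦ fderiv ℝ Q (z₀ + t • x) x) (Icc 0 1) :=
      (((hQ.continuousOn_fderiv_of_isOpen hO (by simp)).mono hsub).comp (hrayc x)
        (hray x hx)).clm_apply continuousOn_const
    have hz := eq_zero_of_hasDerivWithinAt_linear
      (B := fun t ↦ (ContinuousLinearMap.id ℝ F - Q (z₀ + t • x)) ∘L (-θ (z₀ + t • x) x)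
        - fderiv ℝ Q (z₀ + t • x) x)
      (((continuousOn_const.sub hQc).clm_comp (hθc x hx)).sub hDQc)
      (a := fun t ↦ a x t - Q (z₀ + t • x) (a x t)) (by simp [(ha x hx).1, ha₀]) (fun t ht ↦ ?_)
    · exact fun t ht ↦ (sub_eq_zero.1 (hz t ht)).symm
    · have hzO := hsub (hray x hx t ht)
      have h1 : HasDerivWithinAt (fun t : ℝ ↦ Q (z₀ + t • x)) (fderiv ℝ Q (z₀ + t • x) x)
          (Icc 0 1) t :=
        ((((hQ.contDiffAt (hO.mem_nhds hzO)).differentiableAt (by simp)).hasFDerivAt).comp_hasDerivAt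
          t (hasDerivAt_ray z₀ x t)).hasDerivWithinAt
      have h2 := (ha x hx).2 t ht
      refine (h2.sub (h1.clm_apply h2)).congr_deriv ?_
      have h3 := hpar _ hzO x (a x t)
      rw [← sub_eq_zero, ← neg_eq_zero, ← h3]
      simp only [ContinuousLinearMap.comp_apply, sub_apply, neg_apply,
        ContinuousLinearMap.id_apply, map_sub, map_neg]
      abel
  have hdiff : ∀ z ∈ ball z₀ ρ, HasFDerivAt (fun z ↦ a (z - z₀) 1) (-(θ z).flip (a (z - z₀) 1)) z := by
    intro z hz
    have hx : z - z₀ ∈ ball (0 : E) ρ := by simpa [dist_eq_norm] using hz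
    have h1 := hasFDerivAt_radial_transport hK hρ_le hKρ (fun z hz ↦ hb z (hsub₁ hz))
      (fun z hz z' hz' ↦ hb' z (hsub₁ hz) z' (hsub₁ hz')) (fun x hx ↦ (ha x hx).1)
      (fun x hx ↦ (ha x hx).2)
      (fun x hx t ht u v ↦ by rw [← hQa x hx t ht]; exact hflat _ (hsub (hray x hx t ht)) u v _) hx
    have h2 := h1.comp z ((hasFDerivAt_id z).sub_const z₀)
    simpa using! h2
  refine ⟨fun z ↦ a (z - z₀) 1, ?_, contDiffOn_of_parallel isOpen_ball (hθ.mono hsub) hdiff,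
    fun z hz v ↦ by simp [(hdiff z hz).fderiv]⟩
  have h0 : (0 : E) ∈ ball (0 : E) ρ := by simpa using hρ
  -- the transport along the constant ray is constant
  have := eq_zero_of_hasDerivWithinAt_linear (B := 0) continuousOn_const
    (a := fun t ↦ a 0 t - a₀) (by simp [(ha 0 h0).1])
    (fun t ht ↦ by simpa using ((ha 0 h0).2 t ht).sub_const a₀) 1 (by simp)
  simpa [sub_eq_zero] using this

/-- The curvature of `d + θ` vanishes on parallel functions, by symmetry of the second derivative. -/
theorem curvatureForm_apply_of_parallel {a : E → F} {s : Set E} (hs : IsOpen s)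
    (hθ : ContDiffOn ℝ ∞ θ s) (ha : ContDiffOn ℝ ∞ a s)
    (hpar : ∀ z ∈ s, ∀ v, fderiv ℝ a z v + θ z v (a z) = 0) {z : E} (hz : z ∈ s) (u v : E) :
    curvatureForm θ z u v (a z) = 0 := by
  have haz := ha.contDiffAt (hs.mem_nhds hz)
  have hθz : DifferentiableAt ℝ θ z := (hθ.contDiffAt (hs.mem_nhds hz)).differentiableAt (by simp)
  have hda : DifferentiableAt ℝ a z := haz.differentiableAt (by simp)
  have hd : ∀ z ∈ s, fderiv ℝ a z = -(θ z).flip (a z) := fun z hz ↦ by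
    ext v
    simpa using eq_neg_of_add_eq_zero_left (hpar z hz v)
  have hd2 : ∀ u v, fderiv ℝ (fderiv ℝ a) z u v
      = -(fderiv ℝ θ z u v (a z) + θ z v (fderiv ℝ a z u)) := by
    intro u v
    have h1 : fderiv ℝ a =ᶠ[𝓝 z] fun z ↦ -(θ z).flip (a z) :=
      Filter.eventuallyEq_of_mem (hs.mem_nhds hz) hd
    have h2 : HasFDerivAt (fun z ↦ (θ z).flip)
        ((ContinuousLinearMap.flipₗᵢ ℝ E F F).toContinuousLinearEquiv.toContinuousLinearMap ∘L
          fderiv ℝ θ z) z :=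
      (ContinuousLinearMap.flipₗᵢ ℝ E F F).toContinuousLinearEquiv.toContinuousLinearMap.hasFDerivAt.comp
        z hθz.hasFDerivAt
    have h3 : HasFDerivAt (fun z ↦ -(θ z).flip (a z)) _ z := (h2.clm_apply hda.hasFDerivAt).neg
    rw [h1.fderiv_eq, h3.fderiv]
    simp [add_comm]
  have hsymm : fderiv ℝ (fderiv ℝ a) z u v = fderiv ℝ (fderiv ℝ a) z v u :=
    (haz.isSymmSndFDerivAt (by simpa using ENat.LEInfty.out)).eq u v
  rw [hd2, hd2, hd z hz] at hsymm
  simp only [neg_apply, ContinuousLinearMap.flip_apply, map_neg] at hsymm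
  simp only [curvatureForm, add_apply, sub_apply, ContinuousLinearMap.comp_apply]
  rw [← sub_eq_zero] at hsymm
  rw [← neg_eq_zero, ← hsymm]
  abel

end ParallelFunctions

/-! ### Sections in local coordinates -/

section LocalCoordinates

open Set VectorField

variable {E : Type*} [NormedAddCommGroup E] [NormedSpace ℝ E]
  {M : Type*} [TopologicalSpace M] [ChartedSpace E M]
  {F : Type*} [NormedAddCommGroup F] [NormedSpace ℝ F]
  {W : M → Type*} [TopologicalSpace (TotalSpace F W)]
  [∀ x, AddCommGroup (W x)] [∀ x, Module ℝ (W x)] [∀ x, TopologicalSpace (W x)]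
  [FiberBundle F W]

variable (E F W) in
/-- The open subset of `E` over which both the chart and the trivialization at `x` provide
coordinates. -/
def coordImage (x : M) : Set E :=
  (extChartAt 𝓘(ℝ, E) x).target ∩
    (extChartAt 𝓘(ℝ, E) x).symm ⁻¹' (trivializationAt F W x).baseSet

variable (E F W) in
/-- The open subset of `M` on which both the chart and the trivialization at `x` are defined. -/
def coordDomain (x : M) : Set M :=
  (extChartAt 𝓘(ℝ, E) x).source ∩ (trivializationAt F W x).baseSet

/-- The constant vector field on `E` with value `v`. -/
def constField (v : E) : ∀ z : E, TangentSpace 𝓘(ℝ, E) z := fun _ ↦ v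

variable (E) in
/-- The coordinate vector field of the chart at `x` with constant coefficient `v`. -/
def coordField (x : M) (v : E) : ∀ y : M, TangentSpace 𝓘(ℝ, E) y :=
  mpullback 𝓘(ℝ, E) 𝓘(ℝ, E) (extChartAt 𝓘(ℝ, E) x) (constField v)

theorem isOpen_coordImage (x : M) : IsOpen (coordImage E F W x) :=
  (continuousOn_extChartAt_symm x).isOpen_inter_preimage (isOpen_extChartAt_target x)
    (trivializationAt F W x).open_baseSet

theorem isOpen_coordDomain (x : M) : IsOpen (coordDomain E F W x) :=
  (isOpen_extChartAt_source x).inter (trivializationAt F W x).open_baseSet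

theorem mem_coordDomain_self (x : M) : x ∈ coordDomain E F W x :=
  ⟨mem_extChartAt_source x, FiberBundle.mem_baseSet_trivializationAt' x⟩

theorem map_mem_coordImage {x y : M} (hy : y ∈ coordDomain E F W x) :
    extChartAt 𝓘(ℝ, E) x y ∈ coordImage E F W x :=
  ⟨(extChartAt 𝓘(ℝ, E) x).map_source hy.1, by
    rw [Set.mem_preimage, (extChartAt 𝓘(ℝ, E) x).left_inv hy.1]; exact hy.2⟩

theorem symm_map_mem_coordDomain {x : M} {z : E} (hz : z ∈ coordImage E F W x) :
    (extChartAt 𝓘(ℝ, E) x).symm z ∈ coordDomain E F W x :=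
  ⟨(extChartAt 𝓘(ℝ, E) x).map_target hz.1, hz.2⟩

section Chart

variable [IsManifold 𝓘(ℝ, E) ∞ M] {x y : M}

theorem exists_coordField_eq (hy : y ∈ (extChartAt 𝓘(ℝ, E) x).source) (v : TangentSpace 𝓘(ℝ, E) y) :
    ∃ u : E, coordField E x u y = v :=
  ⟨mfderiv 𝓘(ℝ, E) 𝓘(ℝ, E) (extChartAt 𝓘(ℝ, E) x) y v,
    (isInvertible_mfderiv_extChartAt hy).inverse_apply_self v⟩

theorem contMDiff_constField (n : ℕ∞ω) (v : E) :
    ContMDiff 𝓘(ℝ, E) (𝓘(ℝ, E).prod 𝓘(ℝ, E)) n (fun z ↦ TotalSpace.mk' E z (constField v z)) :=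
  fun _ ↦ contMDiffAt_vectorSpace_iff_contDiffAt.2 contDiffAt_const

theorem contMDiffAt_coordField [CompleteSpace E] (hy : y ∈ (extChartAt 𝓘(ℝ, E) x).source) (v : E) :
    ContMDiffAt 𝓘(ℝ, E) (𝓘(ℝ, E).prod 𝓘(ℝ, E)) ∞
      (fun y ↦ TotalSpace.mk' E y (coordField E x v y)) y := by
  have hφ : ContMDiffAt 𝓘(ℝ, E) 𝓘(ℝ, E) ∞ (extChartAt 𝓘(ℝ, E) x) y :=
    contMDiffAt_extChartAt' (by simpa using hy)
  exact ContMDiffAt.mpullback_vectorField_preimage (n := ∞) (contMDiff_constField ∞ v _) hφ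
    (isInvertible_mfderiv_extChartAt hy) (by simp)

theorem mlieBracket_coordField [CompleteSpace E] (hy : y ∈ (extChartAt 𝓘(ℝ, E) x).source)
    (u v : E) : mlieBracket 𝓘(ℝ, E) (coordField E x u) (coordField E x v) y = 0 := by
  have hφ : ContMDiffAt 𝓘(ℝ, E) 𝓘(ℝ, E) ∞ (extChartAt 𝓘(ℝ, E) x) y :=
    contMDiffAt_extChartAt' (by simpa using hy)
  have hc : ∀ v : E, MDifferentiableAt 𝓘(ℝ, E) (𝓘(ℝ, E).prod 𝓘(ℝ, E))
      (fun z : E ↦ TotalSpace.mk' E z (constField v z)) (extChartAt 𝓘(ℝ, E) x y) :=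
    fun v ↦ (contMDiff_constField 1 v _).mdifferentiableAt (by simp)
  have : IsManifold 𝓘(ℝ, E) (minSmoothness ℝ 2) M :=
    IsManifold.of_le (n := ∞) (by simpa using ENat.LEInfty.out)
  have h := mpullback_mlieBracket (I := 𝓘(ℝ, E)) (I' := 𝓘(ℝ, E)) (hc u) (hc v) hφ
    (by simpa using ENat.LEInfty.out)
  have h0 : mlieBracket 𝓘(ℝ, E) (constField u) (constField v) = 0 := by
    rw [← mlieBracketWithin_univ, mlieBracketWithin_eq_lieBracketWithin]
    ext z
    have h1 : lieBracketWithin ℝ (fun _ : E ↦ u) (fun _ : E ↦ v) univ z = 0 := by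
      simp [lieBracketWithin]
    exact h1
  rw [coordField, coordField, ← h, h0, mpullback_zero]
  rfl

/-- A function that is differentiable at a point is differentiable in the chart. -/
theorem differentiableAt_comp_symm {G : Type*} [NormedAddCommGroup G] [NormedSpace ℝ G] {h : M → G}
    (hy : y ∈ (extChartAt 𝓘(ℝ, E) x).source) (hh : MDifferentiableAt 𝓘(ℝ, E) 𝓘(ℝ, G) h y) :
    DifferentiableAt ℝ (h ∘ (extChartAt 𝓘(ℝ, E) x).symm) (extChartAt 𝓘(ℝ, E) x y) := by
  have hz := (extChartAt 𝓘(ℝ, E) x).map_source hy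
  have hs : MDifferentiableAt 𝓘(ℝ, E) 𝓘(ℝ, E) (extChartAt 𝓘(ℝ, E) x).symm
      (extChartAt 𝓘(ℝ, E) x y) :=
    ((contMDiffOn_extChartAt_symm (n := ∞) x).contMDiffAt
      (extChartAt_target_mem_nhds' hz)).mdifferentiableAt (by simp)
  rw [← mdifferentiableAt_iff_differentiableAt]
  refine MDifferentiableAt.comp _ ?_ hs
  rwa [(extChartAt 𝓘(ℝ, E) x).left_inv hy]

theorem contDiffAt_comp_symm {G : Type*} [NormedAddCommGroup G] [NormedSpace ℝ G] {h : M → G}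
    (hy : y ∈ (extChartAt 𝓘(ℝ, E) x).source) (hh : ContMDiffAt 𝓘(ℝ, E) 𝓘(ℝ, G) ∞ h y) :
    ContDiffAt ℝ ∞ (h ∘ (extChartAt 𝓘(ℝ, E) x).symm) (extChartAt 𝓘(ℝ, E) x y) := by
  have hz := (extChartAt 𝓘(ℝ, E) x).map_source hy
  have hs : ContMDiffAt 𝓘(ℝ, E) 𝓘(ℝ, E) ∞ (extChartAt 𝓘(ℝ, E) x).symm
      (extChartAt 𝓘(ℝ, E) x y) :=
    (contMDiffOn_extChartAt_symm x).contMDiffAt (extChartAt_target_mem_nhds' hz)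
  rw [← contMDiffAt_iff_contDiffAt]
  refine ContMDiffAt.comp _ ?_ hs
  rwa [(extChartAt 𝓘(ℝ, E) x).left_inv hy]

/-- The derivative of a function along a coordinate field, computed in the chart. -/
theorem mvfderiv_coordField {G : Type*} [NormedAddCommGroup G] [NormedSpace ℝ G] {h : M → G}
    (hy : y ∈ (extChartAt 𝓘(ℝ, E) x).source) (hh : MDifferentiableAt 𝓘(ℝ, E) 𝓘(ℝ, G) h y) (v : E) :
    mvfderiv 𝓘(ℝ, E) h y (coordField E x v y)
      = fderiv ℝ (h ∘ (extChartAt 𝓘(ℝ, E) x).symm) (extChartAt 𝓘(ℝ, E) x y) v := by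
  have hg := (differentiableAt_comp_symm hy hh).hasFDerivAt.hasMFDerivAt
  have hφ : MDifferentiableAt 𝓘(ℝ, E) 𝓘(ℝ, E) (extChartAt 𝓘(ℝ, E) x) y :=
    mdifferentiableAt_extChartAt (by simpa using hy)
  have h1 := hg.comp y hφ.hasMFDerivAt
  have h2 : h =ᶠ[𝓝 y] (h ∘ (extChartAt 𝓘(ℝ, E) x).symm) ∘ extChartAt 𝓘(ℝ, E) x := by
    filter_upwards [(isOpen_extChartAt_source x).mem_nhds hy] with y' hy'
    simp only [Function.comp_apply, (extChartAt 𝓘(ℝ, E) x).left_inv hy']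
  have h3 := (h1.congr_of_eventuallyEq h2).mfderiv
  have h4 : mfderiv 𝓘(ℝ, E) 𝓘(ℝ, E) (extChartAt 𝓘(ℝ, E) x) y (coordField E x v y) = v :=
    (isInvertible_mfderiv_extChartAt hy).self_apply_inverse _
  change mfderiv 𝓘(ℝ, E) 𝓘(ℝ, G) h y (coordField E x v y) = _
  rw [h3]
  exact congrArg _ h4

end Chart
end LocalCoordinates

section LocalRepresentation

open Set VectorField

variable {E : Type*} [NormedAddCommGroup E] [NormedSpace ℝ E]
  {M : Type*} [TopologicalSpace M] [ChartedSpace E M]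
  {F : Type*} [NormedAddCommGroup F] [NormedSpace ℝ F]
  {W : M → Type*} [TopologicalSpace (TotalSpace F W)]
  [∀ x, AddCommGroup (W x)] [∀ x, Module ℝ (W x)] [∀ x, TopologicalSpace (W x)]
  [FiberBundle F W] [VectorBundle ℝ F W]

variable (F) in
/-- The coordinates of vectors in the fibre over `y`, in the trivialization at `x`. -/
def fiberCoord (x y : M) : W y →L[ℝ] F := (trivializationAt F W x).continuousLinearMapAt ℝ y

variable (E F) in
/-- The local representation of a section: its fibre coordinates in the trivialization at `x`, as a
function of the coordinates of the chart at `x`. -/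
def localRep (x : M) (X : ∀ y, W y) : E → F :=
  (fun y ↦ fiberCoord F x y (X y)) ∘ (extChartAt 𝓘(ℝ, E) x).symm

variable (W) in
/-- The section with a given local representation. -/
def ofLocalRep (x : M) (a : E → F) : ∀ y, W y :=
  fun y ↦ (trivializationAt F W x).symmL ℝ y (a (extChartAt 𝓘(ℝ, E) x y))

variable {x y : M}

theorem localRep_extChartAt (hy : y ∈ coordDomain E F W x) (X : ∀ y, W y) :
    localRep E F x X (extChartAt 𝓘(ℝ, E) x y) = fiberCoord F x y (X y) := by
  simp only [localRep, Function.comp_apply]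
  rw [(extChartAt 𝓘(ℝ, E) x).left_inv hy.1]

theorem localRep_add (X Y : ∀ y, W y) :
    localRep E F x (X + Y) = localRep E F x X + localRep E F x Y := by
  ext z; simp [localRep]

theorem localRep_smul (f : M → ℝ) (X : ∀ y, W y) :
    localRep E F x (f • X) = (f ∘ (extChartAt 𝓘(ℝ, E) x).symm) • localRep E F x X := by
  ext z; simp [localRep]

theorem fiberCoord_injective (hy : y ∈ coordDomain E F W x) :
    Function.Injective (fiberCoord F x y : W y →L[ℝ] F) :=
  Function.LeftInverse.injective ((trivializationAt F W x).symmL_continuousLinearMapAt hy.2)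

theorem localRep_ofLocalRep (a : E → F) {z : E} (hz : z ∈ coordImage E F W x) :
    localRep E F x (ofLocalRep W x a) z = a z := by
  simp only [localRep, ofLocalRep, fiberCoord, Function.comp_apply]
  rw [(trivializationAt F W x).continuousLinearMapAt_symmL hz.2,
    (extChartAt 𝓘(ℝ, E) x).right_inv hz.1]

theorem ofLocalRep_fiberCoord (hy : y ∈ coordDomain E F W x) {a : E → F} {w : W y}
    (h : a (extChartAt 𝓘(ℝ, E) x y) = fiberCoord F x y w) : ofLocalRep W x a y = w := by
  simp only [ofLocalRep, h]
  exact (trivializationAt F W x).symmL_continuousLinearMapAt hy.2 w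

theorem fiberCoord_eventuallyEq (hy : y ∈ coordDomain E F W x) (X : ∀ y, W y) :
    (fun y ↦ fiberCoord F x y (X y)) =ᶠ[𝓝 y] fun y ↦ (trivializationAt F W x ⟨y, X y⟩).2 := by
  filter_upwards [(trivializationAt F W x).open_baseSet.mem_nhds hy.2] with y' hy'
  exact (trivializationAt F W x).continuousLinearMapAt_apply_of_mem ℝ hy' _

variable [IsManifold 𝓘(ℝ, E) ∞ M] [ContMDiffVectorBundle ∞ F W 𝓘(ℝ, E)]

theorem mdifferentiableAt_fiberCoord (hy : y ∈ coordDomain E F W x) {X : ∀ y, W y}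
    (hX : MDifferentiableAt 𝓘(ℝ, E) (𝓘(ℝ, E).prod 𝓘(ℝ, F)) (fun y ↦ TotalSpace.mk' F y (X y)) y) :
    MDifferentiableAt 𝓘(ℝ, E) 𝓘(ℝ, F) (fun y ↦ fiberCoord F x y (X y)) y := by
  have : ContMDiffVectorBundle 1 F W 𝓘(ℝ, E) := .of_le (n := ∞) (by simp)
  exact (((trivializationAt F W x).mdifferentiableAt_section_iff 𝓘(ℝ, E) X hy.2).1
    hX).congr_of_eventuallyEq (fiberCoord_eventuallyEq hy X)

theorem contMDiffAt_fiberCoord (hy : y ∈ coordDomain E F W x) {X : ∀ y, W y}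
    (hX : ContMDiffAt 𝓘(ℝ, E) (𝓘(ℝ, E).prod 𝓘(ℝ, F)) ∞ (fun y ↦ TotalSpace.mk' F y (X y)) y) :
    ContMDiffAt 𝓘(ℝ, E) 𝓘(ℝ, F) ∞ (fun y ↦ fiberCoord F x y (X y)) y :=
  (((trivializationAt F W x).contMDiffAt_section_iff hy.2).1 hX).congr_of_eventuallyEq
    (fiberCoord_eventuallyEq hy X)

theorem differentiableAt_localRep (hy : y ∈ coordDomain E F W x) {X : ∀ y, W y}
    (hX : MDifferentiableAt 𝓘(ℝ, E) (𝓘(ℝ, E).prod 𝓘(ℝ, F)) (fun y ↦ TotalSpace.mk' F y (X y)) y) :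
    DifferentiableAt ℝ (localRep E F x X) (extChartAt 𝓘(ℝ, E) x y) :=
  differentiableAt_comp_symm hy.1 (mdifferentiableAt_fiberCoord hy hX)

theorem contDiffAt_localRep (hy : y ∈ coordDomain E F W x) {X : ∀ y, W y}
    (hX : ContMDiffAt 𝓘(ℝ, E) (𝓘(ℝ, E).prod 𝓘(ℝ, F)) ∞ (fun y ↦ TotalSpace.mk' F y (X y)) y) :
    ContDiffAt ℝ ∞ (localRep E F x X) (extChartAt 𝓘(ℝ, E) x y) :=
  contDiffAt_comp_symm hy.1 (contMDiffAt_fiberCoord hy hX)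

theorem contMDiffAt_ofLocalRep (hy : y ∈ coordDomain E F W x) {a : E → F}
    (ha : ContDiffAt ℝ ∞ a (extChartAt 𝓘(ℝ, E) x y)) :
    ContMDiffAt 𝓘(ℝ, E) (𝓘(ℝ, E).prod 𝓘(ℝ, F)) ∞
      (fun y ↦ TotalSpace.mk' F y (ofLocalRep W x a y)) y := by
  rw [(trivializationAt F W x).contMDiffAt_section_iff hy.2]
  have hφ : ContMDiffAt 𝓘(ℝ, E) 𝓘(ℝ, E) ∞ (extChartAt 𝓘(ℝ, E) x) y :=
    contMDiffAt_extChartAt' (by simpa using hy.1)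
  refine (ha.contMDiffAt.comp y hφ).congr_of_eventuallyEq ?_
  refine (fiberCoord_eventuallyEq hy (ofLocalRep W x a)).symm.trans ?_
  filter_upwards [(trivializationAt F W x).open_baseSet.mem_nhds hy.2] with y' hy'
  simp only [fiberCoord, ofLocalRep, Function.comp_apply]
  exact (trivializationAt F W x).continuousLinearMapAt_symmL hy' _

end LocalRepresentation

/-! ### The connection form and the curvature in coordinates -/

section ConnectionForm

open Set VectorField

variable {E : Type*} [NormedAddCommGroup E] [NormedSpace ℝ E] [FiniteDimensional ℝ E]
  {M : Type*} [TopologicalSpace M] [T2Space M] [ChartedSpace E M] [IsManifold 𝓘(ℝ, E) ∞ M]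
  {F : Type*} [NormedAddCommGroup F] [NormedSpace ℝ F] [FiniteDimensional ℝ F]
  {W : M → Type*} [TopologicalSpace (TotalSpace F W)]
  [∀ x, AddCommGroup (W x)] [∀ x, Module ℝ (W x)] [∀ x, TopologicalSpace (W x)]
  [∀ x, IsTopologicalAddGroup (W x)] [∀ x, ContinuousSMul ℝ (W x)]
  [FiberBundle F W] [VectorBundle ℝ F W] [ContMDiffVectorBundle ∞ F W 𝓘(ℝ, E)]

/-- The connection form of a covariant derivative in the coordinates at `x`: the `F`-component of
the covariant derivatives of the sections with constant coefficients. These are expanded in a basis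
of `F`, so that linearity in the coefficients holds by definition, also outside the domain of the
coordinates. -/
def connectionForm (cov : CovariantDerivative 𝓘(ℝ, E) F W) (x : M) (z : E) : E →L[ℝ] F →L[ℝ] F :=
  ∑ i, (ContinuousLinearMap.smulRightL ℝ F F
      (LinearMap.toContinuousLinearMap ((Module.finBasis ℝ F).coord i))) ∘L
    ((fiberCoord F x ((extChartAt 𝓘(ℝ, E) x).symm z) ∘L
      cov (ofLocalRep W x fun _ : E ↦ Module.finBasis ℝ F i) ((extChartAt 𝓘(ℝ, E) x).symm z)) ∘L
      (mfderiv 𝓘(ℝ, E) 𝓘(ℝ, E) (extChartAt 𝓘(ℝ, E) x) ((extChartAt 𝓘(ℝ, E) x).symm z)).inverse)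

theorem connectionForm_apply (cov : CovariantDerivative 𝓘(ℝ, E) F W) (x : M) (z v : E) (f : F) :
    connectionForm cov x z v f = ∑ i, (Module.finBasis ℝ F).coord i f •
      localRep E F x (fun y ↦ cov (ofLocalRep W x fun _ : E ↦ Module.finBasis ℝ F i) y
        (coordField E x v y)) z := by
  simp [connectionForm]
  rfl

variable {x y : M}

theorem contMDiffAt_cov_coordField (cov : CovariantDerivative 𝓘(ℝ, E) F W)
    [CovariantDerivative.ContMDiffCovariantDerivative cov ∞] {U : Set M} {X : ∀ y, W y}
    (hX : IsSmoothSectionOn E F U X) (hyU : y ∈ U) (hy : y ∈ coordDomain E F W x) (v : E) :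
    ContMDiffAt 𝓘(ℝ, E) (𝓘(ℝ, E).prod 𝓘(ℝ, F)) ∞
      (fun y ↦ TotalSpace.mk' F y (cov X y (coordField E x v y))) y :=
  (contMDiffAt_cov cov hX hyU).clm_bundle_apply (contMDiffAt_coordField hy.1 v)

theorem isSmoothSectionOn_ofLocalRep_const (f : F) :
    IsSmoothSectionOn E F (coordDomain E F W x) (ofLocalRep W x fun _ : E ↦ f) :=
  ⟨isOpen_coordDomain x, fun _ hy ↦
    (contMDiffAt_ofLocalRep hy contDiffAt_const).contMDiffWithinAt⟩

theorem contDiffOn_connectionForm (cov : CovariantDerivative 𝓘(ℝ, E) F W)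
    [CovariantDerivative.ContMDiffCovariantDerivative cov ∞] (x : M) :
    ContDiffOn ℝ ∞ (connectionForm cov x) (coordImage E F W x) := by
  rw [contDiffOn_clm_apply]
  intro v
  rw [contDiffOn_clm_apply]
  intro f
  simp only [connectionForm_apply]
  refine ContDiffOn.sum fun i _ ↦ contDiffOn_const.smul fun z hz ↦ ?_
  have hy := symm_map_mem_coordDomain hz
  have h := contDiffAt_localRep hy (contMDiffAt_cov_coordField cov
    (isSmoothSectionOn_ofLocalRep_const (Module.finBasis ℝ F i)) hy hy v)
  rw [(extChartAt 𝓘(ℝ, E) x).right_inv hz.1] at h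
  exact h.contDiffWithinAt

/-- The covariant derivative in coordinates is `d + θ`, with `θ` the connection form. -/
theorem fiberCoord_cov (cov : CovariantDerivative 𝓘(ℝ, E) F W)
    (hy : y ∈ coordDomain E F W x) {X : ∀ y, W y}
    (hX : MDifferentiableAt 𝓘(ℝ, E) (𝓘(ℝ, E).prod 𝓘(ℝ, F)) (fun y ↦ TotalSpace.mk' F y (X y)) y)
    (v : E) :
    fiberCoord F x y (cov X y (coordField E x v y))
      = fderiv ℝ (localRep E F x X) (extChartAt 𝓘(ℝ, E) x y) v
        + connectionForm cov x (extChartAt 𝓘(ℝ, E) x y) v (fiberCoord F x y (X y)) := by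
  have : ContMDiffVectorBundle 1 F W 𝓘(ℝ, E) := .of_le (n := ∞) (by simp)
  -- the difference of both derivatives is tensorial in the section
  set Φ : (∀ y, W y) → F := fun X ↦ fiberCoord F x y (cov X y (coordField E x v y))
    - fderiv ℝ (localRep E F x X) (extChartAt 𝓘(ℝ, E) x y) v with hΦdef
  have hΦ : TensorialAt 𝓘(ℝ, E) F Φ y := by
    constructor
    · intro f σ hf hσ
      have h1 := cov.isCovariantDerivativeOnUniv.leibniz hσ hf
      have h2 := (differentiableAt_comp_symm hy.1 hf)
      have h3 := differentiableAt_localRep hy hσ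
      have h4 := mvfderiv_coordField hy.1 hf v
      simp only [hΦdef, h1, localRep_smul]
      rw [fderiv_smul h2 h3]
      simp only [add_apply, smul_apply, map_add, map_smul,
        ContinuousLinearMap.smulRight_apply, Function.comp_apply, h4,
        (extChartAt 𝓘(ℝ, E) x).left_inv hy.1, localRep_extChartAt hy]
      simp only [Function.comp_def]
      module
    · intro σ σ' hσ hσ'
      simp only [hΦdef, cov.isCovariantDerivativeOnUniv.add hσ hσ', localRep_add]
      rw [fderiv_add (differentiableAt_localRep hy hσ) (differentiableAt_localRep hy hσ')]
      simp only [add_apply, map_add]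
      abel
  -- hence it may be computed on a section with constant coefficients
  set f := fiberCoord F x y (X y)
  set b := Module.finBasis ℝ F
  set c : Fin (finrank ℝ F) → ∀ y, W y := fun i ↦ ofLocalRep W x fun _ : E ↦ b i with hc
  have hcd : ∀ i, MDifferentiableAt 𝓘(ℝ, E) (𝓘(ℝ, E).prod 𝓘(ℝ, F))
      (fun y ↦ TotalSpace.mk' F y (c i y)) y := fun i ↦
    (isSmoothSectionOn_ofLocalRep_const (b i)).mdifferentiableAt hy
  have hscd : ∀ i ∈ Finset.univ, MDifferentiableAt 𝓘(ℝ, E) (𝓘(ℝ, E).prod 𝓘(ℝ, F))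
      (fun y' ↦ TotalSpace.mk' F y' (((fun _ : M ↦ b.coord i f) • c i) y')) y := fun i _ ↦
    mdifferentiableAt_const.smul_section (hcd i)
  have hval : X y = ∑ i, ((fun _ : M ↦ b.coord i f) • c i) y := by
    simp only [Pi.smul_apply', hc, ofLocalRep, ← map_smul, ← map_sum, Basis.coord_apply, b.sum_repr]
    exact ((trivializationAt F W x).symmL_continuousLinearMapAt hy.2 (X y)).symm
  have h1 : Φ X = ∑ i, Φ ((fun _ : M ↦ b.coord i f) • c i) := by
    rw [← hΦ.sum _ hscd]
    exact hΦ.pointwise hX (.sum_section hscd) hval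
  have h2 : ∀ i, Φ ((fun _ : M ↦ b.coord i f) • c i)
      = b.coord i f • fiberCoord F x y (cov (c i) y (coordField E x v y)) := by
    intro i
    rw [hΦ.smul mdifferentiableAt_const (hcd i)]
    have h3 : localRep E F x (c i) =ᶠ[𝓝 (extChartAt 𝓘(ℝ, E) x y)] fun _ ↦ b i := by
      filter_upwards [(isOpen_coordImage (F := F) (W := W) x).mem_nhds (map_mem_coordImage hy)]
        with z hz using localRep_ofLocalRep _ hz
    simp only [hΦdef]
    rw [h3.fderiv_eq]
    simp
  have h4 : connectionForm cov x (extChartAt 𝓘(ℝ, E) x y) v f = Φ X := by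
    rw [h1, connectionForm_apply]
    exact Finset.sum_congr rfl fun i _ ↦ by rw [h2, localRep_extChartAt hy]
  rw [h4]
  exact (add_sub_cancel _ _).symm

/-- The curvature operator depends on the first vector field only through its value. -/
theorem curvatureOp_congr_left (cov : CovariantDerivative 𝓘(ℝ, E) F W)
    [CovariantDerivative.ContMDiffCovariantDerivative cov ∞] {U : Set M} {X : ∀ y, W y}
    (hX : IsSmoothSectionOn E F U X) (hy : y ∈ U) {A A' B : ∀ y : M, TangentSpace 𝓘(ℝ, E) y}
    (hA : ContMDiffAt 𝓘(ℝ, E) (𝓘(ℝ, E).prod 𝓘(ℝ, E)) ∞ (fun y ↦ TotalSpace.mk' E y (A y)) y)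
    (hA' : ContMDiffAt 𝓘(ℝ, E) (𝓘(ℝ, E).prod 𝓘(ℝ, E)) ∞ (fun y ↦ TotalSpace.mk' E y (A' y)) y)
    (h : A y = A' y) : curvatureOp cov A B X y = curvatureOp cov A' B X y := by
  have : IsManifold 𝓘(ℝ, E) 2 M := IsManifold.of_le (n := ∞) ENat.LEInfty.out
  have hcovX : ∀ {A : ∀ y : M, TangentSpace 𝓘(ℝ, E) y}, MDifferentiableAt 𝓘(ℝ, E)
      (𝓘(ℝ, E).prod 𝓘(ℝ, E)) (fun y ↦ TotalSpace.mk' E y (A y)) y →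
      MDifferentiableAt 𝓘(ℝ, E) (𝓘(ℝ, E).prod 𝓘(ℝ, F))
        (fun y ↦ TotalSpace.mk' F y (cov X y (A y))) y := fun hA ↦
    ((contMDiffAt_cov cov hX hy).mdifferentiableAt (by simp)).clm_bundle_apply hA
  have hΦ : TensorialAt 𝓘(ℝ, E) E (fun A ↦ curvatureOp cov A B X y) y := by
    constructor
    · intro f σ hf hσ
      have h1 : (fun y ↦ cov X y ((f • σ) y)) = f • fun y ↦ cov X y (σ y) := by
        ext y'; simp
      simp only [curvatureOp, h1, cov.isCovariantDerivativeOnUniv.leibniz (hcovX hσ) hf,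
        mlieBracket_smul_left hf hσ]
      simp
      module
    · intro σ σ' hσ hσ'
      have h1 : (fun y ↦ cov X y ((σ + σ') y))
          = (fun y ↦ cov X y (σ y)) + fun y ↦ cov X y (σ' y) := by
        ext y'; simp
      simp only [curvatureOp, h1, cov.isCovariantDerivativeOnUniv.add (hcovX hσ) (hcovX hσ'),
        mlieBracket_add_left hσ hσ']
      simp
      abel
  exact hΦ.pointwise (hA.mdifferentiableAt (by simp)) (hA'.mdifferentiableAt (by simp)) h

theorem curvatureOp_swap (cov : CovariantDerivative 𝓘(ℝ, E) F W)
    (A B : ∀ y : M, TangentSpace 𝓘(ℝ, E) y) (X : ∀ y, W y) (y : M) :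
    curvatureOp cov A B X y = -curvatureOp cov B A X y := by
  simp only [curvatureOp, mlieBracket_swap_apply (V := A) (W := B), map_neg]
  abel

/-- The curvature tensor in coordinates is the curvature of the connection form. -/
theorem fiberCoord_curvature (cov : CovariantDerivative 𝓘(ℝ, E) F W)
    [CovariantDerivative.ContMDiffCovariantDerivative cov ∞] (hy : y ∈ coordDomain E F W x)
    (u v : E) (w : W y) :
    fiberCoord F x y (curvature cov y (coordField E x u y) (coordField E x v y) w)
      = curvatureForm (connectionForm cov x) (extChartAt 𝓘(ℝ, E) x y) u v (fiberCoord F x y w) := by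
  set X : ∀ y, W y := FiberBundle.extend F w with hXdef
  set U := (trivializationAt F W y).baseSet
  have hX : IsSmoothSectionOn E F U X := isSmoothSectionOn_extend w
  have hyU : y ∈ U := FiberBundle.mem_baseSet_trivializationAt' y
  have hXy : X y = w := by simp [hXdef]
  have hext := fun v : TangentSpace 𝓘(ℝ, E) y ↦ FiberBundle.contMDiffAt_extend 𝓘(ℝ, E) E (k := ∞) v
  have hcf := fun v : E ↦ contMDiffAt_coordField hy.1 v
  -- the vector fields that extend the two vectors may be taken to be coordinate fields
  have h1 : curvature cov y (coordField E x u y) (coordField E x v y) w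
      = curvatureOp cov (coordField E x u) (coordField E x v) X y := by
    rw [curvature, curvatureOp_congr_left cov hX hyU (hext _) (hcf u) (by simp), curvatureOp_swap,
      curvatureOp_congr_left cov hX hyU (hext _) (hcf v) (by simp), ← curvatureOp_swap]
  set θ := connectionForm cov x
  set z := extChartAt 𝓘(ℝ, E) x y with hz
  set a := localRep E F x X with ha
  have hθz : DifferentiableAt ℝ θ z := ((contDiffOn_connectionForm cov x).contDiffAt
    ((isOpen_coordImage x).mem_nhds (map_mem_coordImage hy))).differentiableAt (by simp)
  have haz : ContDiffAt ℝ ∞ a z := contDiffAt_localRep hy (hX.2.contMDiffAt (hX.1.mem_nhds hyU))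
  have hda : DifferentiableAt ℝ a z := haz.differentiableAt (by simp)
  have hdda : DifferentiableAt ℝ (fderiv ℝ a) z :=
    (haz.fderiv_right (m := ∞) (by simp)).differentiableAt (by simp)
  -- the second covariant derivatives
  have h2 : ∀ u v : E, fiberCoord F x y
      (cov (fun y ↦ cov X y (coordField E x v y)) y (coordField E x u y))
      = fderiv ℝ (fderiv ℝ a) z u v + (fderiv ℝ θ z u v (a z) + θ z v (fderiv ℝ a z u))
        + θ z u (fderiv ℝ a z v + θ z v (a z)) := by
    intro u v
    rw [fiberCoord_cov cov hy ((contMDiffAt_cov_coordField cov hX hyU hy v).mdifferentiableAt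
      (by simp)), fiberCoord_cov cov hy (hX.mdifferentiableAt hyU)]
    have h3 : localRep E F x (fun y ↦ cov X y (coordField E x v y))
        =ᶠ[𝓝 z] fun z ↦ fderiv ℝ a z v + θ z v (a z) := by
      have hcont : ContinuousAt (extChartAt 𝓘(ℝ, E) x).symm z :=
        continuousAt_extChartAt_symm' hy.1
      have hU : ∀ᶠ z' in 𝓝 z, (extChartAt 𝓘(ℝ, E) x).symm z' ∈ U := by
        refine hcont.eventually (p := (· ∈ U)) ?_
        rw [hz, (extChartAt 𝓘(ℝ, E) x).left_inv hy.1]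
        exact hX.1.mem_nhds hyU
      filter_upwards [hU, (isOpen_coordImage (F := F) (W := W) x).mem_nhds (map_mem_coordImage hy)]
        with z' hz'U hz'
      have hy' := symm_map_mem_coordDomain hz'
      have h4 := fiberCoord_cov cov hy' (hX.mdifferentiableAt hz'U) v
      rw [← localRep_extChartAt hy', (extChartAt 𝓘(ℝ, E) x).right_inv hz'.1] at h4
      rw [localRep, Function.comp_apply, h4]
    have h5 : HasFDerivAt (fun z ↦ fderiv ℝ a z v + θ z v (a z)) _ z :=
      (hdda.hasFDerivAt.clm_apply (hasFDerivAt_const v z)).add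
        ((hθz.hasFDerivAt.clm_apply (hasFDerivAt_const v z)).clm_apply hda.hasFDerivAt)
    rw [h3.fderiv_eq, h5.fderiv, ← localRep_extChartAt hy]
    simp [a, z]
    abel
  have hsymm : fderiv ℝ (fderiv ℝ a) z u v = fderiv ℝ (fderiv ℝ a) z v u :=
    (haz.isSymmSndFDerivAt (by simpa using ENat.LEInfty.out)).eq u v
  have haz' : a z = fiberCoord F x y w := by rw [ha, hz, localRep_extChartAt hy, hXy]
  rw [h1, curvatureOp, mlieBracket_coordField hy.1, map_zero, sub_zero, map_sub, h2, h2, hsymm, haz']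
  simp only [curvatureForm, add_apply, sub_apply, ContinuousLinearMap.comp_apply, map_add]
  abel

end ConnectionForm

/-! ### Projections onto a subbundle with a frame -/

section FrameProjection

open Set

/-- A smooth family of vectors of `F`, linearly independent at `z₀`, admits near `z₀` a smooth family
of projections onto the span of the vectors. -/
theorem exists_contDiffOn_projection {E F : Type*} [NormedAddCommGroup E] [NormedSpace ℝ E]
    [NormedAddCommGroup F] [NormedSpace ℝ F] [FiniteDimensional ℝ F] {O : Set E} (hO : IsOpen O)
    {z₀ : E} (hz₀ : z₀ ∈ O) {n : ℕ} {e : Fin n → E → F} (he : ∀ i, ContDiffOn ℝ ∞ (e i) O)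
    (hli : LinearIndependent ℝ fun i ↦ e i z₀) :
    ∃ (O' : Set E) (Q : E → F →L[ℝ] F), IsOpen O' ∧ z₀ ∈ O' ∧ O' ⊆ O ∧ ContDiffOn ℝ ∞ Q O' ∧
      ∀ z ∈ O', (∀ f, Q z f ∈ Submodule.span ℝ (range fun i ↦ e i z)) ∧
        ∀ f ∈ Submodule.span ℝ (range fun i ↦ e i z), Q z f = f := by
  set G : E → (Fin n → ℝ) →L[ℝ] F := fun z ↦
    ∑ i, (ContinuousLinearMap.proj (R := ℝ) (φ := fun _ : Fin n ↦ ℝ) i).smulRight (e i z) with hG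
  have hGapp : ∀ z c, G z c = ∑ i, c i • e i z := fun z c ↦ by simp [hG]
  have hGs : ContDiffOn ℝ ∞ G O := by
    refine ContDiffOn.sum fun i _ ↦ ?_
    exact (ContinuousLinearMap.smulRightL ℝ (Fin n → ℝ) F
      (ContinuousLinearMap.proj (R := ℝ) (φ := fun _ : Fin n ↦ ℝ) i)).contDiff.comp_contDiffOn (he i)
  have hspan : ∀ z f, f ∈ Submodule.span ℝ (range fun i ↦ e i z) ↔ ∃ c, G z c = f := fun z f ↦ by
    simp_rw [hGapp]; exact Submodule.mem_span_range_iff_exists_fun ℝ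
  have hinj : LinearMap.ker (G z₀ : (Fin n → ℝ) →ₗ[ℝ] F) = ⊥ := by
    rw [LinearMap.ker_eq_bot']
    intro c hc
    have hc' : ∑ i, c i • e i z₀ = 0 := by rw [← hGapp]; exact hc
    exact funext (Fintype.linearIndependent_iff.1 hli c hc')
  obtain ⟨l, hl⟩ := LinearMap.exists_leftInverse_of_injective _ hinj
  set L : F →L[ℝ] (Fin n → ℝ) := LinearMap.toContinuousLinearMap l
  set N : E → (Fin n → ℝ) →L[ℝ] (Fin n → ℝ) := fun z ↦ L ∘L G z
  have hN : ContDiffOn ℝ ∞ N O := contDiffOn_const.clm_comp hGs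
  have hN₀ : N z₀ = 1 := by
    ext1 c; exact LinearMap.congr_fun hl c
  set O' := O ∩ N ⁻¹' {u | IsUnit u}
  refine ⟨O', fun z ↦ G z ∘L (Ring.inverse (N z) ∘L L),
    hN.continuousOn.isOpen_inter_preimage hO Units.isOpen, ⟨hz₀, by simp [hN₀]⟩, inter_subset_left,
    ?_, fun z hz ↦ ⟨fun f ↦ (hspan z _).2 ⟨_, rfl⟩, fun f hf ↦ ?_⟩⟩
  · refine (hGs.mono inter_subset_left).clm_comp (ContDiffOn.clm_comp (fun z hz ↦ ?_)
      contDiffOn_const)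
    obtain ⟨u, hu⟩ := hz.2
    have h1 : ContDiffAt ℝ ∞ Ring.inverse (N z) := by
      rw [← hu]; exact contDiffAt_ringInverse ℝ u
    exact (h1.comp z (hN.contDiffAt (hO.mem_nhds hz.1))).contDiffWithinAt
  · obtain ⟨c, rfl⟩ := (hspan z f).1 hf
    have h1 : Ring.inverse (N z) (N z c) = c :=
      congrArg (fun T : (Fin n → ℝ) →L[ℝ] (Fin n → ℝ) ↦ T c) (Ring.inverse_mul_cancel _ hz.2)
    exact congrArg (G z) h1

end FrameProjection

section MaximalFlat

open Set

variable {E : Type*} [NormedAddCommGroup E] [NormedSpace ℝ E] [FiniteDimensional ℝ E]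
  {M : Type*} [TopologicalSpace M] [T2Space M] [ChartedSpace E M] [IsManifold 𝓘(ℝ, E) ∞ M]
  {F : Type*} [NormedAddCommGroup F] [NormedSpace ℝ F] [FiniteDimensional ℝ F]
  {W : M → Type*} [TopologicalSpace (TotalSpace F W)]
  [∀ x, AddCommGroup (W x)] [∀ x, Module ℝ (W x)] [∀ x, TopologicalSpace (W x)]
  [∀ x, IsTopologicalAddGroup (W x)] [∀ x, ContinuousSMul ℝ (W x)]
  [FiberBundle F W] [VectorBundle ℝ F W] [ContMDiffVectorBundle ∞ F W 𝓘(ℝ, E)]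
  {x y : M}

theorem linearIndependent_fiberCoord_iff {ι : Type*} (hy : y ∈ coordDomain E F W x) {w : ι → W y} :
    (LinearIndependent ℝ fun i ↦ fiberCoord F x y (w i)) ↔ LinearIndependent ℝ w := by
  set L : W y →ₗ[ℝ] F := (fiberCoord F x y).toLinearMap
  have hL : LinearMap.ker L = ⊥ := LinearMap.ker_eq_bot.2 (fiberCoord_injective hy)
  exact ⟨fun h ↦ LinearIndependent.of_comp L h, fun h ↦ h.map' L hL⟩

theorem eventually_linearIndependent {ι : Type*} [Finite ι] {X : ι → ∀ y, W y} {U : ι → Set M}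
    (hX : ∀ i, IsSmoothSectionOn E F (U i) (X i)) (hy : ∀ i, y ∈ U i)
    (hli : LinearIndependent ℝ fun i ↦ X i y) :
    ∀ᶠ y' in 𝓝 y, LinearIndependent ℝ fun i ↦ X i y' := by
  have hyd := mem_coordDomain_self (E := E) (F := F) (W := W) y
  have hc : ContinuousAt (fun y' i ↦ fiberCoord F y y' (X i y')) y :=
    continuousAt_pi.2 fun i ↦ (contMDiffAt_fiberCoord hyd
      ((hX i).2.contMDiffAt ((hX i).1.mem_nhds (hy i)))).continuousAt
  have hev := hc.eventually (isOpen_setOfPred_linearIndependent.mem_nhds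
    ((linearIndependent_fiberCoord_iff hyd).2 hli))
  filter_upwards [hev, (isOpen_coordDomain y).mem_nhds hyd] with y' h1 h2
  exact (linearIndependent_fiberCoord_iff h2).1 h1

theorem isOpen_preimage_coord (x : M) {U : Set M} (hU : IsOpen U) :
    IsOpen (coordImage E F W x ∩ (extChartAt 𝓘(ℝ, E) x).symm ⁻¹' U) :=
  ((continuousOn_extChartAt_symm x).mono inter_subset_left).isOpen_inter_preimage
    (isOpen_coordImage x) hU

theorem isOpen_coordDomain_inter_preimage (x : M) {O : Set E} (hO : IsOpen O) :
    IsOpen (coordDomain E F W x ∩ extChartAt 𝓘(ℝ, E) x ⁻¹' O) :=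
  ((continuousOn_extChartAt x).mono inter_subset_left).isOpen_inter_preimage
    (isOpen_coordDomain x) hO

theorem contDiffOn_localRep {X : ∀ y, W y} {U : Set M} (hX : IsSmoothSectionOn E F U X) (x : M) :
    ContDiffOn ℝ ∞ (localRep E F x X)
      (coordImage E F W x ∩ (extChartAt 𝓘(ℝ, E) x).symm ⁻¹' U) := by
  intro z hz
  have h := contDiffAt_localRep (symm_map_mem_coordDomain hz.1)
    (hX.2.contMDiffAt (hX.1.mem_nhds hz.2))
  rw [(extChartAt 𝓘(ℝ, E) x).right_inv hz.1.1] at h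
  exact h.contDiffWithinAt

/-- A subbundle with a smooth frame near `x` has, in coordinates, a smooth family of projections
onto its fibres. -/
theorem exists_projection_of_frame {S : ∀ y, Submodule ℝ (W y)} {U : Set M} {n : ℕ}
    {X : Fin n → ∀ y, W y} (hU : IsOpen U) (hxU : x ∈ U) (hX : ∀ i, IsSmoothSectionOn E F U (X i))
    (hS : ∀ y ∈ U, LinearIndependent ℝ (fun i ↦ X i y) ∧
      Submodule.span ℝ (range fun i ↦ X i y) = S y) :
    ∃ (O : Set E) (Q : E → F →L[ℝ] F), IsOpen O ∧ extChartAt 𝓘(ℝ, E) x x ∈ O ∧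
      O ⊆ coordImage E F W x ∩ (extChartAt 𝓘(ℝ, E) x).symm ⁻¹' U ∧ ContDiffOn ℝ ∞ Q O ∧
      ∀ y ∈ coordDomain E F W x, extChartAt 𝓘(ℝ, E) x y ∈ O →
        (∀ f, ∃ w ∈ S y, fiberCoord F x y w = Q (extChartAt 𝓘(ℝ, E) x y) f) ∧
        ∀ w ∈ S y, Q (extChartAt 𝓘(ℝ, E) x y) (fiberCoord F x y w) = fiberCoord F x y w := by
  have hxd := mem_coordDomain_self (E := E) (F := F) (W := W) x
  obtain ⟨O, Q, hO, hxO, hsub, hQ, hspan⟩ := exists_contDiffOn_projection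
    (isOpen_preimage_coord (E := E) (F := F) (W := W) x hU) (z₀ := extChartAt 𝓘(ℝ, E) x x)
    ⟨map_mem_coordImage hxd, by simpa using hxU⟩ (fun i ↦ contDiffOn_localRep (hX i) x) (by
      simp_rw [localRep_extChartAt hxd]
      exact (linearIndependent_fiberCoord_iff hxd).2 (hS x hxU).1)
  refine ⟨O, Q, hO, hxO, hsub, hQ, fun y hy hyO ↦ ?_⟩
  have hyU : y ∈ U := by
    have := (hsub hyO).2
    rwa [mem_preimage, (extChartAt 𝓘(ℝ, E) x).left_inv hy.1] at this
  have h1 : Submodule.span ℝ (range fun i ↦ localRep E F x (X i) (extChartAt 𝓘(ℝ, E) x y))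
      = (S y).map (fiberCoord F x y : W y →L[ℝ] F).toLinearMap := by
    rw [← (hS y hyU).2, Submodule.map_span, ← range_comp]
    simp_rw [localRep_extChartAt hy]
    rfl
  obtain ⟨h2, h3⟩ := hspan _ hyO
  rw [h1] at h2 h3
  exact ⟨fun f ↦ h2 f, fun w hw ↦ h3 _ ⟨w, hw, rfl⟩⟩

/-! ### The derived flag near a regular point -/

theorem smoothPart_le (S : ∀ y, Submodule ℝ (W y)) (y : M) : smoothPart E F S y ≤ S y := by
  rintro _ ⟨U, X, hyU, hX, rfl⟩
  exact hX.2 y hyU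

theorem secondFundamentalKernel_le (cov : CovariantDerivative 𝓘(ℝ, E) F W)
    (S : ∀ y, Submodule ℝ (W y)) (y : M) : secondFundamentalKernel cov S y ≤ S y := by
  rintro _ ⟨U, X, hyU, hX, rfl, -⟩
  exact hX.2 y hyU

/-- The rank of the set of vectors that lie on smooth sections of `S` is lower semicontinuous. -/
theorem eventually_finrank_smoothPart_le (S : ∀ y, Submodule ℝ (W y)) (y : M) :
    ∀ᶠ y' in 𝓝 y, finrank ℝ (smoothPart E F S y) ≤ finrank ℝ (smoothPart E F S y') := by
  have hfd : ∀ y, FiniteDimensional ℝ (W y) := fun y ↦ VectorBundle.finiteDimensional ℝ F W y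
  set b := Module.finBasis ℝ (smoothPart E F S y)
  choose U X hyU hX hXy using fun i ↦ (b i).2
  have hli : LinearIndependent ℝ fun i ↦ X i y := by
    simp_rw [hXy]
    exact b.linearIndependent.map' (smoothPart E F S y).subtype (Submodule.ker_subtype _)
  have hU : ∀ᶠ y' in 𝓝 y, ∀ i, y' ∈ U i :=
    Filter.eventually_all.2 fun i ↦ (hX i).1.1.mem_nhds (hyU i)
  filter_upwards [hU, eventually_linearIndependent (fun i ↦ (hX i).1) hyU hli] with y' hy' hli'
  have hli'' : LinearIndependent ℝ
      fun i ↦ (⟨X i y', U i, X i, hy' i, hX i, rfl⟩ : smoothPart E F S y') :=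
    LinearIndependent.of_comp (smoothPart E F S y').subtype hli'
  simpa using hli''.fintype_card_le_finrank

variable (cov : CovariantDerivative 𝓘(ℝ, E) F W)
  [CovariantDerivative.ContMDiffCovariantDerivative cov ∞]

theorem derivedFlag_succ_le (i : ℕ) (y : M) : derivedFlag cov (i + 1) y ≤ derivedFlag cov i y :=
  (smoothPart_le _ y).trans (secondFundamentalKernel_le cov _ y)

theorem antitone_derivedFlag (y : M) : Antitone fun i ↦ derivedFlag cov i y :=
  antitone_nat_of_succ_le fun i ↦ derivedFlag_succ_le cov i y

theorem eventually_finrank_derivedFlag_le (i : ℕ) (y : M) :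
    ∀ᶠ y' in 𝓝 y, finrank ℝ (derivedFlag cov i y) ≤ finrank ℝ (derivedFlag cov i y') := by
  cases i <;> exact eventually_finrank_smoothPart_le _ y

theorem maximalFlat_le (i : ℕ) (y : M) : maximalFlat cov y ≤ derivedFlag cov i y := iInf_le _ i

theorem exists_derivedFlag_eq_maximalFlat (y : M) :
    ∃ k, derivedFlag cov k y = maximalFlat cov y := by
  have hfd : FiniteDimensional ℝ (W y) := VectorBundle.finiteDimensional ℝ F W y
  obtain ⟨k, hk⟩ := IsArtinian.monotone_stabilizes (R := ℝ) (M := W y)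
    ⟨fun i ↦ OrderDual.toDual (derivedFlag cov i y), fun i j hij ↦ antitone_derivedFlag cov y hij⟩
  refine ⟨k, le_antisymm (le_iInf fun i ↦ ?_) (maximalFlat_le cov k y)⟩
  rcases le_total k i with h | h
  · exact le_of_eq (hk i h)
  · exact antitone_derivedFlag cov y h

/-- Where the maximal flat subset has constant rank, it coincides, near each point of a dense set,
with some member of the derived flag. The ranks in the flag are lower semicontinuous, so the sets where a
given member has stabilized are closed, and Baire's theorem applies. -/
theorem exists_eventually_derivedFlag_eq {V : Set M} (hV : IsOpen V) (hne : V.Nonempty) {n : ℕ}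
    (hn : ∀ y ∈ V, finrank ℝ (maximalFlat cov y) = n) :
    ∃ y ∈ V, ∃ k, ∀ᶠ y' in 𝓝 y, derivedFlag cov k y' = maximalFlat cov y' := by
  have hfd : ∀ y, FiniteDimensional ℝ (W y) := fun y ↦ VectorBundle.finiteDimensional ℝ F W y
  have : LocallyCompactSpace M := Manifold.locallyCompact_of_finiteDimensional 𝓘(ℝ, E)
  set C : ℕ → Set M := fun k ↦ {y | y ∈ V → finrank ℝ (derivedFlag cov k y) ≤ n} with hC
  have hclosed : ∀ k, IsClosed (C k) := by
    intro k
    rw [← isOpen_compl_iff, isOpen_iff_mem_nhds]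
    intro y hy
    simp only [hC, mem_compl_iff, mem_ofPred_eq, Classical.not_imp, not_le] at hy
    filter_upwards [hV.mem_nhds hy.1, eventually_finrank_derivedFlag_le cov k y] with y' h1 h2
    simp only [hC, mem_compl_iff, mem_ofPred_eq, Classical.not_imp, not_le]
    exact ⟨h1, hy.2.trans_le h2⟩
  have hcover : ⋃ k, C k = univ := by
    refine eq_univ_of_forall fun y ↦ ?_
    obtain ⟨k, hk⟩ := exists_derivedFlag_eq_maximalFlat cov y
    exact mem_iUnion.2 ⟨k, fun hy ↦ by rw [hk, hn y hy]⟩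
  obtain ⟨y, hyV, hy⟩ := (dense_iUnion_interior_of_closed hclosed hcover).inter_open_nonempty
    V hV hne
  obtain ⟨k, hk⟩ := mem_iUnion.1 hy
  refine ⟨y, hyV, k, ?_⟩
  filter_upwards [hV.mem_nhds hyV, mem_interior_iff_mem_nhds.1 hk] with y' h1 h2
  exact (Submodule.eq_of_le_of_finrank_le (maximalFlat_le cov k y')
    (by rw [hn y' h1]; exact h2 h1)).symm

/-- In coordinates, the projections onto a subbundle that agrees near `y` with a member `W⁽ᵏ⁾` of
the derived flag are parallel at `y` in the direction of those vectors over `y` that lie in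
`W⁽ᵏ⁺¹⁾`: such a vector extends to a section of the subbundle whose covariant derivative at `y` is
again in the subbundle. -/
theorem fderiv_projection_eq_zero {S : ∀ y, Submodule ℝ (W y)} {O : Set E} {Q : E → F →L[ℝ] F}
    (hO : IsOpen O) (hQ : DifferentiableOn ℝ Q O) (hy : y ∈ coordDomain E F W x)
    (hyO : extChartAt 𝓘(ℝ, E) x y ∈ O)
    (hQS : ∀ y ∈ coordDomain E F W x, extChartAt 𝓘(ℝ, E) x y ∈ O → ∀ w ∈ S y,
      Q (extChartAt 𝓘(ℝ, E) x y) (fiberCoord F x y w) = fiberCoord F x y w)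
    {k : ℕ} (hk : ∀ᶠ y' in 𝓝 y, derivedFlag cov k y' = S y') {w : W y}
    (hw : w ∈ derivedFlag cov (k + 1) y) (v : E) :
    fderiv ℝ Q (extChartAt 𝓘(ℝ, E) x y) v (fiberCoord F x y w)
      + (connectionForm cov x (extChartAt 𝓘(ℝ, E) x y) v (fiberCoord F x y w)
        - Q (extChartAt 𝓘(ℝ, E) x y)
          (connectionForm cov x (extChartAt 𝓘(ℝ, E) x y) v (fiberCoord F x y w))) = 0 := by
  obtain ⟨U, X, hyU, hX, hXy, hα⟩ := smoothPart_le _ y hw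
  set z := extChartAt 𝓘(ℝ, E) x y with hz
  set a := localRep E F x X with ha
  have hda : DifferentiableAt ℝ a z := differentiableAt_localRep hy (hX.1.mdifferentiableAt hyU)
  have hcov : ∀ v, cov X y v ∈ S y := fun v ↦ by
    rw [← hk.self_of_nhds]
    exact (Submodule.Quotient.mk_eq_zero _).1 (LinearMap.congr_fun hα v)
  have hsymm : Filter.Tendsto (extChartAt 𝓘(ℝ, E) x).symm (𝓝 z) (𝓝 y) := by
    have h := continuousAt_extChartAt_symm' (I := 𝓘(ℝ, E)) hy.1
    rwa [ContinuousAt, (extChartAt 𝓘(ℝ, E) x).left_inv hy.1] at h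
  -- the section takes values in the subbundle near `y`, so `a = Q a` near `z`
  have hQa : a =ᶠ[𝓝 z] fun z' ↦ Q z' (a z') := by
    filter_upwards [hsymm.eventually hk, hsymm.eventually (hX.1.1.mem_nhds hyU), hO.mem_nhds hyO,
      (isOpen_coordImage (F := F) (W := W) x).mem_nhds (map_mem_coordImage hy)] with z' h1 h2 h3 h4
    have h5 := hQS _ (symm_map_mem_coordDomain h4) (by
      rwa [(extChartAt 𝓘(ℝ, E) x).right_inv h4.1]) _ (h1 ▸ hX.2 _ h2)
    rw [(extChartAt 𝓘(ℝ, E) x).right_inv h4.1] at h5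
    exact h5.symm
  have hQz : DifferentiableAt ℝ Q z := hQ.differentiableAt (hO.mem_nhds hyO)
  have h1 : fderiv ℝ a z v = Q z (fderiv ℝ a z v) + fderiv ℝ Q z v (a z) := by
    conv_lhs => rw [hQa.fderiv_eq, fderiv_clm_apply hQz hda]
    simp
  have h2 := hQS y hy hyO _ (hcov (coordField E x v y))
  rw [fiberCoord_cov cov hy (hX.1.mdifferentiableAt hyU), hXy] at h2
  have h3 : a z = fiberCoord F x y w := by rw [ha, hz, localRep_extChartAt hy, hXy]
  rw [← hz, ← ha, map_add] at h2
  rw [h3] at h1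
  rw [eq_sub_of_add_eq' h1.symm, sub_eq_sub_iff_add_eq_add.2 ((add_comm _ _).trans h2.symm)]
  abel

/-- Near a regular point the maximal flat subset is invariant under the connection. By
`exists_eventually_derivedFlag_eq` this holds on a dense set, and it is a closed condition. -/
theorem projection_parallel {U : Set M} {n : ℕ} {O : Set E} {Q : E → F →L[ℝ] F}
    (hn : ∀ y ∈ U, finrank ℝ (maximalFlat cov y) = n)
    (hO : IsOpen O) (hOU : O ⊆ coordImage E F W x ∩ (extChartAt 𝓘(ℝ, E) x).symm ⁻¹' U)
    (hQ : ContDiffOn ℝ ∞ Q O)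
    (hQS : ∀ y ∈ coordDomain E F W x, extChartAt 𝓘(ℝ, E) x y ∈ O →
      (∀ f, ∃ w ∈ maximalFlat cov y, fiberCoord F x y w = Q (extChartAt 𝓘(ℝ, E) x y) f) ∧
      ∀ w ∈ maximalFlat cov y,
        Q (extChartAt 𝓘(ℝ, E) x y) (fiberCoord F x y w) = fiberCoord F x y w)
    {z : E} (hz : z ∈ O) (v : E) (f : F) :
    fderiv ℝ Q z v (Q z f)
      + (connectionForm cov x z v (Q z f) - Q z (connectionForm cov x z v (Q z f))) = 0 := by
  set H : E → F := fun z ↦ fderiv ℝ Q z v (Q z f)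
      + (connectionForm cov x z v (Q z f) - Q z (connectionForm cov x z v (Q z f))) with hH
  have hθ : ContinuousOn (connectionForm cov x) O :=
    (contDiffOn_connectionForm cov x).continuousOn.mono fun z hz ↦ (hOU hz).1
  have hQf : ContinuousOn (fun z ↦ Q z f) O := hQ.continuousOn.clm_apply continuousOn_const
  have hθQ : ContinuousOn (fun z ↦ connectionForm cov x z v (Q z f)) O :=
    (hθ.clm_apply continuousOn_const).clm_apply hQf
  have hHc : ContinuousOn H O :=
    (((hQ.continuousOn_fderiv_of_isOpen hO (by simp)).clm_apply continuousOn_const).clm_apply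
      hQf).add (hθQ.sub (hQ.continuousOn.clm_apply hθQ))
  by_contra hne
  have hO' : IsOpen (O ∩ H ⁻¹' {0}ᶜ) := hHc.isOpen_inter_preimage hO isOpen_compl_singleton
  set V := coordDomain E F W x ∩ extChartAt 𝓘(ℝ, E) x ⁻¹' (O ∩ H ⁻¹' {0}ᶜ) with hV
  have hVU : ∀ y ∈ V, y ∈ U := fun y hy ↦ by
    have := (hOU hy.2.1).2
    rwa [mem_preimage, (extChartAt 𝓘(ℝ, E) x).left_inv hy.1.1] at this
  have hVne : V.Nonempty := by
    refine ⟨(extChartAt 𝓘(ℝ, E) x).symm z, symm_map_mem_coordDomain (hOU hz).1, ?_⟩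
    rw [mem_preimage, (extChartAt 𝓘(ℝ, E) x).right_inv (hOU hz).1.1]
    exact ⟨hz, hne⟩
  obtain ⟨y, hyV, k, hk⟩ := exists_eventually_derivedFlag_eq cov
    (isOpen_coordDomain_inter_preimage x hO') hVne fun y hy ↦ hn y (hVU y hy)
  refine hyV.2.2 ?_
  obtain ⟨w, hw, hwf⟩ := (hQS y hyV.1 hyV.2.1).1 f
  have h := fderiv_projection_eq_zero cov hO (hQ.differentiableOn (by simp)) hyV.1 hyV.2.1
    (fun y hy hyO ↦ (hQS y hy hyO).2) hk (maximalFlat_le cov (k + 1) y hw) v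
  rw [hwf] at h
  exact h

/-! ### Parallel sections -/

section Parallel

variable {cov} {U : Set M} {X : ∀ y, W y}

/-- In coordinates, a parallel section solves the equation `da + θ a = 0`. -/
theorem IsParallelOn.fderiv_localRep (hX : IsParallelOn cov U X) {z : E}
    (hz : z ∈ coordImage E F W x ∩ (extChartAt 𝓘(ℝ, E) x).symm ⁻¹' U) (v : E) :
    fderiv ℝ (localRep E F x X) z v + connectionForm cov x z v (localRep E F x X z) = 0 := by
  have h := fiberCoord_cov cov (symm_map_mem_coordDomain hz.1) (hX.1.mdifferentiableAt hz.2) v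
  rw [hX.2 _ hz.2, ← localRep_extChartAt (symm_map_mem_coordDomain hz.1),
    (extChartAt 𝓘(ℝ, E) x).right_inv hz.1.1] at h
  exact h.symm.trans (map_zero (fiberCoord F x _))

/-- Conversely, a solution of `da + θ a = 0` is the local representation of a parallel section. -/
theorem isParallelOn_ofLocalRep {O : Set E} (hO : IsOpen O) {a : E → F} (ha : ContDiffOn ℝ ∞ a O)
    (hpar : ∀ z ∈ O, ∀ v, fderiv ℝ a z v + connectionForm cov x z v (a z) = 0) :
    IsParallelOn cov (coordDomain E F W x ∩ extChartAt 𝓘(ℝ, E) x ⁻¹' O) (ofLocalRep W x a) := by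
  have hs : IsSmoothSectionOn E F (coordDomain E F W x ∩ extChartAt 𝓘(ℝ, E) x ⁻¹' O)
      (ofLocalRep W x a) := ⟨isOpen_coordDomain_inter_preimage x hO, fun y hy ↦
    (contMDiffAt_ofLocalRep hy.1 (ha.contDiffAt (hO.mem_nhds hy.2))).contMDiffWithinAt⟩
  refine ⟨hs, fun y hy ↦ ?_⟩
  ext v
  obtain ⟨u, rfl⟩ := exists_coordField_eq hy.1.1 v
  have hev : localRep E F x (ofLocalRep W x a) =ᶠ[𝓝 (extChartAt 𝓘(ℝ, E) x y)] a := by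
    filter_upwards [(isOpen_coordImage (F := F) (W := W) x).mem_nhds (map_mem_coordImage hy.1)]
      with z hz using localRep_ofLocalRep a hz
  apply fiberCoord_injective hy.1
  rw [fiberCoord_cov cov hy.1 (hs.mdifferentiableAt hy), ← localRep_extChartAt hy.1, hev.fderiv_eq,
    hev.eq_of_nhds, hpar _ hy.2]
  simp

theorem IsParallelOn.add {Y : ∀ y, W y} (hX : IsParallelOn cov U X) (hY : IsParallelOn cov U Y) :
    IsParallelOn cov U (X + Y) :=
  ⟨⟨hX.1.1, hX.1.2.add_section hY.1.2⟩, fun y hy ↦ by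
    rw [cov.isCovariantDerivativeOnUniv.add (hX.1.mdifferentiableAt hy)
      (hY.1.mdifferentiableAt hy), hX.2 y hy, hY.2 y hy, add_zero]⟩

theorem IsParallelOn.const_smul (c : ℝ) (hX : IsParallelOn cov U X) :
    IsParallelOn cov U (c • X) :=
  ⟨⟨hX.1.1, hX.1.2.const_smul_section⟩, fun y hy ↦ by
    rw [cov.isCovariantDerivativeOnUniv.smul_const c (hX.1.mdifferentiableAt hy), hX.2 y hy,
      smul_zero]⟩

theorem isParallelOn_zero (hU : IsOpen U) : IsParallelOn cov U (0 : ∀ y, W y) :=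
  ⟨⟨hU, (contMDiff_zeroSection (IB := 𝓘(ℝ, E)) ℝ W).contMDiffOn⟩, fun y _ ↦ by
    simp⟩

theorem isParallelOn_sum {ι : Type*} (s : Finset ι) (hU : IsOpen U) {X : ι → ∀ y, W y}
    (hX : ∀ i ∈ s, IsParallelOn cov U (X i)) : IsParallelOn cov U (∑ i ∈ s, X i) :=
  Finset.sum_induction X (IsParallelOn cov U) (fun _ _ ↦ .add) (isParallelOn_zero hU) hX

/-- A parallel section is determined near a point by its value there. -/
theorem IsParallelOn.eventually_eq_zero (hX : IsParallelOn cov U X) (hxU : x ∈ U) (h0 : X x = 0) :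
    ∀ᶠ y in 𝓝 x, X y = 0 := by
  have hxd := mem_coordDomain_self (E := E) (F := F) (W := W) x
  obtain ⟨ρ, hρ, hball⟩ := Metric.isOpen_iff.1
    (isOpen_preimage_coord (E := E) (F := F) (W := W) x hX.1.1) (extChartAt 𝓘(ℝ, E) x x)
    ⟨map_mem_coordImage hxd, by simpa using hxU⟩
  have h := eq_zero_of_parallel (a := localRep E F x X) (z₀ := extChartAt 𝓘(ℝ, E) x x)
    ((contDiffOn_connectionForm cov x).continuousOn.mono fun z hz ↦ (hball hz).1)
    (fun z hz ↦ ((contDiffOn_localRep hX.1 x).contDiffAt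
      ((isOpen_preimage_coord x hX.1.1).mem_nhds (hball hz))).differentiableAt (by simp))
    (fun z hz v ↦ hX.fderiv_localRep (hball hz) v)
    (by rw [localRep_extChartAt hxd, h0, map_zero])
  filter_upwards [(isOpen_coordDomain (E := E) (F := F) (W := W) x).mem_nhds hxd,
    (continuousAt_extChartAt (I := 𝓘(ℝ, E)) x).preimage_mem_nhds (Metric.ball_mem_nhds _ hρ)]
    with y hy hyb
  apply fiberCoord_injective hy
  rw [map_zero, ← localRep_extChartAt hy]
  exact h _ hyb

theorem IsParallelOn.mem_curvatureKernel (hX : IsParallelOn cov U X) (hyU : y ∈ U) :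
    X y ∈ curvatureKernel cov y := by
  intro u v
  have hyd := mem_coordDomain_self (E := E) (F := F) (W := W) y
  obtain ⟨u, rfl⟩ := exists_coordField_eq hyd.1 u
  obtain ⟨v, rfl⟩ := exists_coordField_eq hyd.1 v
  apply fiberCoord_injective hyd
  rw [fiberCoord_curvature cov hyd, ← localRep_extChartAt hyd, map_zero]
  exact curvatureForm_apply_of_parallel (isOpen_preimage_coord y hX.1.1)
    ((contDiffOn_connectionForm cov y).mono inter_subset_left) (contDiffOn_localRep hX.1 y)
    (fun z hz v ↦ hX.fderiv_localRep hz v) ⟨map_mem_coordImage hyd, by simpa using hyU⟩ u v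

/-- Parallel sections take their values in every member of the derived flag. -/
theorem IsParallelOn.mem_maximalFlat (hX : IsParallelOn cov U X) (hyU : y ∈ U) :
    X y ∈ maximalFlat cov y := by
  refine (Submodule.mem_iInf _).2 fun i ↦ ?_
  induction i generalizing y with
  | zero => exact ⟨U, X, hyU, ⟨hX.1, fun y hy ↦ hX.mem_curvatureKernel hy⟩, rfl⟩
  | succ i ih =>
    refine ⟨U, X, hyU, ⟨hX.1, fun y hy ↦ ⟨U, X, hy, ⟨hX.1, fun y hy ↦ ih hy⟩, rfl, ?_⟩⟩, rfl⟩
    ext v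
    simp [secondFundamentalForm, hX.2 y hy]

end Parallel

/-- Through the vectors of the maximal flat subset over a regular point pass parallel sections, all
defined on the same neighbourhood. -/
theorem exists_isParallelOn (hx : IsRegularAt cov x) :
    ∃ U : Set M, IsOpen U ∧ x ∈ U ∧ ∀ w ∈ maximalFlat cov x, ∃ X, IsParallelOn cov U X ∧ X x = w := by
  obtain ⟨U₀, hU₀, hxU₀, hsub⟩ := hx
  obtain ⟨U, n, e, hxU, -, he, hU, hspan⟩ := hsub x hxU₀
  have hn : ∀ y ∈ U, finrank ℝ (maximalFlat cov y) = n := fun y hy ↦ by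
    rw [← (hspan y hy).2, finrank_span_eq_card (hspan y hy).1, Fintype.card_fin]
  obtain ⟨O, Q, hO, hxO, hOU, hQ, hQS⟩ := exists_projection_of_frame hU hxU he hspan
  have hxd := mem_coordDomain_self (E := E) (F := F) (W := W) x
  have hflat : ∀ z ∈ O, ∀ u v f, curvatureForm (connectionForm cov x) z u v (Q z f) = 0 := by
    intro z hz u v f
    have hy := symm_map_mem_coordDomain (hOU hz).1
    have hyz := (extChartAt 𝓘(ℝ, E) x).right_inv (hOU hz).1.1
    obtain ⟨w, hw, hwf⟩ := (hQS _ hy (by rwa [hyz])).1 f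
    have h := fiberCoord_curvature cov hy u v w
    rw [hwf, hyz, smoothPart_le _ _ (maximalFlat_le cov 0 _ hw) _ _, map_zero] at h
    exact h.symm
  obtain ⟨ρ, hρ, -, ha⟩ := exists_parallel hO hxO
    ((contDiffOn_connectionForm cov x).mono fun z hz ↦ (hOU hz).1) hQ
    (fun z hz v f ↦ projection_parallel cov hn hO hOU hQ hQS hz v f) hflat
  refine ⟨_, isOpen_coordDomain_inter_preimage x Metric.isOpen_ball,
    ⟨hxd, Metric.mem_ball_self hρ⟩, fun w hw ↦ ?_⟩
  obtain ⟨a, ha₀, has, hapar⟩ := ha (fiberCoord F x x w) ((hQS x hxd hxO).2 w hw)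
  exact ⟨ofLocalRep W x a, isParallelOn_ofLocalRep Metric.isOpen_ball has hapar,
    ofLocalRep_fiberCoord hxd ha₀⟩

end MaximalFlat

end ParallelSections

end

theorem corollary3
    {E : Type*} [NormedAddCommGroup E] [NormedSpace ℝ E] [FiniteDimensional ℝ E]
    {M : Type*} [TopologicalSpace M] [T2Space M] [ChartedSpace E M] [IsManifold 𝓘(ℝ, E) ∞ M]
    {F : Type*} [NormedAddCommGroup F] [NormedSpace ℝ F] [FiniteDimensional ℝ F]
    {W : M → Type*} [TopologicalSpace (TotalSpace F W)]
    [∀ x, AddCommGroup (W x)] [∀ x, Module ℝ (W x)] [∀ x, TopologicalSpace (W x)]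
    [∀ x, IsTopologicalAddGroup (W x)] [∀ x, ContinuousSMul ℝ (W x)]
    [FiberBundle F W] [VectorBundle ℝ F W] [ContMDiffVectorBundle ∞ F W 𝓘(ℝ, E)]
    (cov : CovariantDerivative 𝓘(ℝ, E) F W) [CovariantDerivative.ContMDiffCovariantDerivative cov ∞]
    (x : M) (hx : ParallelSections.IsRegularAt cov x) :
    -- there are `dim W̃_x` independent parallel sections on a common neighbourhood of `x`
    (∃ (U : Set M)
        (X : Fin (finrank ℝ (ParallelSections.maximalFlat cov x)) → ∀ y, W y),
      IsOpen U ∧ x ∈ U ∧ (∀ i, ParallelSections.IsParallelOn cov U (X i)) ∧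
      ∀ y ∈ U, LinearIndependent ℝ (fun i ↦ X i y)) ∧
    -- and no more: parallel sections near `x` whose germs at `x` are linearly independent
    -- number at most `dim W̃_x`
    (∀ (m : ℕ) (U : Set M) (Y : Fin m → ∀ y, W y), x ∈ U →
      (∀ i, ParallelSections.IsParallelOn cov U (Y i)) →
      (∀ c : Fin m → ℝ, (∀ᶠ y in 𝓝 x, ∑ i, c i • Y i y = 0) → c = 0) →
      m ≤ finrank ℝ (ParallelSections.maximalFlat cov x)) := by
  have hfd : FiniteDimensional ℝ (W x) := VectorBundle.finiteDimensional ℝ F W x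
  constructor
  · obtain ⟨U, hU, hxU, hpar⟩ := ParallelSections.exists_isParallelOn cov hx
    let b := Module.finBasis ℝ (ParallelSections.maximalFlat cov x)
    choose X hX hXx using fun i ↦ hpar (b i) (b i).2
    have hli : LinearIndependent ℝ fun i ↦ X i x := by
      simp_rw [hXx]
      exact b.linearIndependent.map' _ (Submodule.ker_subtype _)
    obtain ⟨V, hV, hVo, hxV⟩ := eventually_nhds_iff.1
      (ParallelSections.eventually_linearIndependent (fun i ↦ (hX i).1) (fun _ ↦ hxU) hli)
    exact ⟨U ∩ V, X, hU.inter hVo, ⟨hxU, hxV⟩, fun i ↦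
      ⟨⟨hU.inter hVo, (hX i).1.2.mono Set.inter_subset_left⟩, fun y hy ↦ (hX i).2 y hy.1⟩,
      fun y hy ↦ hV y hy.2⟩
  · intro m U Y hxU hY hgerm
    rcases Nat.eq_zero_or_pos m with rfl | hm
    · exact Nat.zero_le _
    have hU : IsOpen U := (hY ⟨0, hm⟩).1.1
    have hli : LinearIndependent ℝ fun i ↦ Y i x := by
      refine Fintype.linearIndependent_iff.2 fun c hc ↦ congrFun (hgerm c ?_)
      have h := (ParallelSections.isParallelOn_sum Finset.univ hU
        fun i _ ↦ (hY i).const_smul (c i)).eventually_eq_zero hxU (by simpa using hc)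
      simpa using h
    have hli' : LinearIndependent ℝ fun i ↦
        (⟨Y i x, (hY i).mem_maximalFlat hxU⟩ : ParallelSections.maximalFlat cov x) :=
      LinearIndependent.of_comp (ParallelSections.maximalFlat cov x).subtype hli
    simpa using hli'.fintype_card_le_finrank
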